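/- Let $G=(V,E)$ be a finite simple undirected graph with $n$ vertices, each undirected edge being regarded as a pair of directed edges; let $m=\sum_{v\in V}d(v)\ge 1$ be the number of directed edges, and let each vertex have an arbitrary fixed ordering of its neighbors. An algorithm may access $G$ only through vertex queries (returning a uniformly random vertex), degree queries (given $v$, returning $d(v)$) and neighbor queries (given $v$ and $i$, returning the $i$-th neighbor of $v$, or failing if $i>d(v)$). There are a single randomized algorithm (a fixed program for a randomized word RAM with words of $O(\log (n\lceil 1/\varepsilon\rceil))$ bits, unit-cost instructions and uniform random choice from $\{1,\dots,r\}$ as an instruction) and absolute constants $C,k$ such that for every $0<\varepsilon<1$ and every such $G$ the algorithm, given only $n$ and $\lceil 1/\varepsilon\rceil$ as input and query access to $G$, satisfies the following. 1. It makes $\tilde O\big(n/\sqrt{\varepsilon m}\big)$ queries in expectation; explicitly, at most $C\,\frac{n}{\sqrt{\varepsilon m}}\,(\log n)^k$. 2. It halts with probability $1$, and its running time is linear in the number of queries: every halting run takes at most $C$ times as many steps as it makes queries. 3. It returns an edge of $G$ with probability at least $2/3$; otherwise it reports failure (it returns a non-edge with probability $0$). 4. Conditioned on an edge being returned, the returned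 directed edge has a distribution $P$ that is pointwise $\varepsilon$-close to uniform, i.e. $|P(e)-\tfrac1m|\le \tfrac{\varepsilon}{m}$ for every directed edge $e$. (Hence the underlying undirected edge is pointwise $\varepsilon$-close to uniform as well.) -/

import Mathlib

open scoped ENNReal

namespace EdgeSampling

/-! ### Pointwise closeness of distributions -/

/-- `P` is pointwise `ε`-close to `Q`: `|P x - Q x| ≤ ε * Q x` for every `x`. -/
def PointwiseClose {Ω : Type*} (ε : ℝ) (P Q : PMF Ω) : Prop :=
  ∀ x, |(P x).toReal - (Q x).toReal| ≤ ε * (Q x).toReal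

/-! ### Programs: a randomized word RAM with vertex, degree and neighbor queries

The machine has a memory `mem` of machine words (natural numbers below a modulus `W`) and a memory
`vtx` of vertex names.  Vertex names are opaque: the only vertices a program can speak about are
those that it has received as answers to queries, and it can do nothing with them but copy them,
compare them, query them and return them.  A program is one fixed finite piece of syntax that
mentions neither the graph nor the parameters. -/

/-- Word-valued expressions: constants, memory access (with indirect addressing), arithmetic. -/
inductive Expr : Type
  | lit (k : ℕ)
  | get (addr : Expr)
  | add (a b : Expr)
  | sub (a b : Expr)
  | mul (a b : Expr)
  | div (a b : Expr)

/-- Tests: comparison of words, "does this vertex cell hold a vertex", equality of vertex cells. -/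
inductive Test : Type
  | le (a b : Expr)
  | isVertex (a : Expr)
  | sameVertex (a b : Expr)

/-- Programs. -/
inductive Cmd : Type
  /-- `mem[a] := e` -/
  | assign (a e : Expr)
  /-- `mem[a] :=` a uniformly random element of `{1, …, e}` (and `0` if `e = 0`) -/
  | random (a e : Expr)
  /-- `vtx[a] := vtx[b]` -/
  | copyVertex (a b : Expr)
  /-- vertex query: `vtx[a] :=` a uniformly random vertex -/
  | vertexQuery (a : Expr)
  /-- degree query: `mem[a] :=` the degree of `vtx[b]` -/
  | degreeQuery (a b : Expr)
  /-- neighbor query: `vtx[a] :=` the `i`-th neighbor of `vtx[b]`, or "no vertex" on failure -/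
  | neighborQuery (a b i : Expr)
  | seq (s t : Cmd)
  | cond (b : Test) (s t : Cmd)
  | loop (b : Test) (s : Cmd)
  /-- halt and return the pair `(vtx[a], vtx[b])` (or "fail" if a cell is empty) -/
  | ret (a b : Expr)
  /-- halt and return "fail" -/
  | fail

/-- A configuration.  `code` is the stack of commands still to be executed; the machine has halted
when it is empty, and then `result` is its output (`none` is "fail").  `queries` and `time` count
the queries made and the steps executed so far. -/
structure Config (V : Type*) where
  code : List Cmd
  mem : ℕ → ℕ
  vtx : ℕ → Option V
  result : Option (V × V)
  queries : ℕ
  time : ℕ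

/-- Value of an expression, in arithmetic modulo `W` (subtraction is truncated at `0`, and
division is integer division, with `x / 0 = 0`). -/
def Expr.eval (W : ℕ) (mem : ℕ → ℕ) : Expr → ℕ
  | .lit k => k % W
  | .get a => mem (a.eval W mem)
  | .add a b => (a.eval W mem + b.eval W mem) % W
  | .sub a b => a.eval W mem - b.eval W mem
  | .mul a b => (a.eval W mem * b.eval W mem) % W
  | .div a b => a.eval W mem / b.eval W mem

section Semantics

variable {V : Type*}

def Test.Holds (W : ℕ) (mem : ℕ → ℕ) (vtx : ℕ → Option V) : Test → Prop
  | .le a b => a.eval W mem ≤ b.eval W mem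
  | .isVertex a => (vtx (a.eval W mem)).isSome
  | .sameVertex a b => vtx (a.eval W mem) = vtx (b.eval W mem)

def Config.Halted (c : Config V) : Prop := c.code = []

/-- A uniformly random element of `{1, …, k}`, and `0` if `k = 0`. -/
noncomputable def uniformUpTo (k : ℕ) : PMF ℕ :=
  if h : (Finset.Icc 1 k).Nonempty then PMF.uniformOfFinset (Finset.Icc 1 k) h else PMF.pure 0

variable [Fintype V] [Nonempty V] (G : SimpleGraph V) [DecidableRel G.Adj]
  (nbr : (v : V) → Fin (G.degree v) ≃ G.neighborSet v)

/-- Answer to a degree query (`0` if it is asked about an empty cell). -/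
def degreeAnswer : Option V → ℕ
  | some v => G.degree v
  | none => 0

/-- Answer to a neighbor query: the `i`-th neighbor of `v` in the order fixed by `nbr`, for
`i = 1, …, d(v)`, and failure otherwise. -/
def neighborAnswer (x : Option V) (i : ℕ) : Option V :=
  match x with
  | some v => if h : 1 ≤ i ∧ i ≤ G.degree v then some (nbr v ⟨i - 1, by omega⟩ : V) else none
  | none => none

open Classical in
/-- Execution of the command `s` when the stack below it is `rest`; the counters of `c` are changed
only to count queries. -/
noncomputable def exec (W : ℕ) (c : Config V) (rest : List Cmd) : Cmd → PMF (Config V)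
  | .assign a e =>
      PMF.pure { c with
        code := rest
        mem := Function.update c.mem (a.eval W c.mem) (e.eval W c.mem) }
  | .random a e =>
      (uniformUpTo (e.eval W c.mem)).map fun r =>
        { c with code := rest, mem := Function.update c.mem (a.eval W c.mem) r }
  | .copyVertex a b =>
      PMF.pure { c with
        code := rest
        vtx := Function.update c.vtx (a.eval W c.mem) (c.vtx (b.eval W c.mem)) }
  | .vertexQuery a =>
      (PMF.uniformOfFintype V).map fun v =>
        { c with
          code := rest
          vtx := Function.update c.vtx (a.eval W c.mem) (some v)
          queries := c.queries + 1 }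
  | .degreeQuery a b =>
      PMF.pure { c with
        code := rest
        mem := Function.update c.mem (a.eval W c.mem)
          (degreeAnswer G (c.vtx (b.eval W c.mem)) % W)
        queries := c.queries + 1 }
  | .neighborQuery a b i =>
      PMF.pure { c with
        code := rest
        vtx := Function.update c.vtx (a.eval W c.mem)
          (neighborAnswer G nbr (c.vtx (b.eval W c.mem)) (i.eval W c.mem))
        queries := c.queries + 1 }
  | .seq s t => PMF.pure { c with code := s :: t :: rest }
  | .cond b s t =>
      PMF.pure { c with code := if b.Holds W c.mem c.vtx then s :: rest else t :: rest }
  | .loop b s =>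
      PMF.pure { c with code := if b.Holds W c.mem c.vtx then s :: .loop b s :: rest else rest }
  | .ret a b =>
      PMF.pure { c with
        code := []
        result := (c.vtx (a.eval W c.mem)).bind fun u =>
          (c.vtx (b.eval W c.mem)).map fun v => (u, v) }
  | .fail => PMF.pure { c with code := [], result := none }

/-- One step of the machine; every step takes one unit of time, and halted configurations do not
change any more. -/
noncomputable def step (W : ℕ) (c : Config V) : PMF (Config V) :=
  match c.code with
  | [] => PMF.pure c
  | s :: rest => exec G nbr W { c with time := c.time + 1 } rest s

/-- The initial configuration: the input words are in the cells `0, 1, …`, and all other cells are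
empty. -/
def init (W : ℕ) (prog : Cmd) (input : List ℕ) : Config V where
  code := [prog]
  mem := fun i => input.getD i 0 % W
  vtx := fun _ => none
  result := none
  queries := 0
  time := 0

/-- The law of the configuration after `t` steps. -/
noncomputable def law (W : ℕ) (prog : Cmd) (input : List ℕ) : ℕ → PMF (Config V)
  | 0 => PMF.pure (init W prog input)
  | t + 1 => (law W prog input t).bind (step G nbr W)

/-- Probability that the machine halts with an output in `S` (as a supremum of the probabilities
that it does so within `t` steps, which increase with `t`). -/
noncomputable def outputProb (W : ℕ) (prog : Cmd) (input : List ℕ)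
    (S : Set (Option (V × V))) : ℝ≥0∞ :=
  ⨆ t, (law G nbr W prog input t).toOuterMeasure {c | c.Halted ∧ c.result ∈ S}

/-- Expected number of queries of the whole run (as a supremum of the expected numbers of queries
made within `t` steps, which increase with `t`). -/
noncomputable def expectedQueries (W : ℕ) (prog : Cmd) (input : List ℕ) : ℝ≥0∞ :=
  ⨆ t, ∑' c, law G nbr W prog input t c * (c.queries : ℝ≥0∞)

/-- On every run that halts, the number of steps is at most `C` times the number of queries. -/
def LinearTime (C : ℕ) (W : ℕ) (prog : Cmd) (input : List ℕ) : Prop :=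
  ∀ t, ∀ c ∈ (law G nbr W prog input t).support, c.Halted → c.time ≤ C * c.queries

end Semantics

/-- The machine handles words of `κ * ⌈log₂ (n * N)⌉` bits. -/
def wordModulus (κ n N : ℕ) : ℕ := 2 ^ (κ * Nat.clog 2 (n * N))

end EdgeSampling

/-! Write `m` for the number of directed edges, `N = ⌈1/ε⌉`, `L = ⌈log₂ n⌉`. Fix a degree threshold
`θ` and call a vertex light if its degree is at most `θ`. An attempt draws a vertex `u`, gives up
unless `u` is light, and draws an index in `{1, …, θ}`; rejecting indices beyond the degree gives
each directed edge `(u, v)` at a light `u` the same probability `1/(nθ)`. A fair coin then decides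
between returning `(u, v)` and, if `v` is heavy, returning a random edge at `v`. An edge at a light
`x` is thus returned with probability `1/(2nθ)`, and an edge at a heavy `x` with that probability
times the fraction of light neighbors of `x` (`trial_apply`). At most `m/θ` vertices are heavy, so
this fraction is at least `1 - η` once `m ≤ ηθ²` (`one_sub_le_edgeWeight`). Here `η = 1/(4N)`.

The right threshold is about `√(Nm)`, but `m` is unknown. Attempt `i` therefore uses `θ = K/i`, for
`i` from `t₀ = 8192NL` to `K = 2nt₀`, so that `θ` falls from `2n` to `1`. Attempts with `θ ≥ τ`,
where `τ ≈ min(n, √(4Nm))`, are almost unbiased. Their success probabilities, about `mi/(2nK)`, add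
up to enough that all of them fail with probability `δ ≤ 1/(8Nmn)` (`one_sub_successBound_pow_le`).
The biased attempts after them then hardly affect the law (`abs_div_sub_inv_le`) or the expected
cost, which is governed by `K/τ`, of order `n √(N/m) L`, or by a geometric bound if `τ = n`
(`trials_le`).

The program is tied to this process by `Simulates`, a step-bounded coupling of machine runs with
outcomes of an abstract law (`Simulates.exists_coupling`), which transfers output law, query count
and running time. -/

namespace EdgeSampling

/-! ### Expectations of nonnegative functions under a `PMF` -/

section Expectation

/-- The expectation of a nonnegative function. -/
noncomputable def expect {α : Type*} (p : PMF α) (f : α → ℝ≥0∞) : ℝ≥0∞ := ∑' a, p a * f a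

variable {α β : Type*}

theorem expect_pure (a : α) (f : α → ℝ≥0∞) : expect (PMF.pure a) f = f a := by
  rw [expect, tsum_eq_single a]
  · simp
  · intro b hb; simp [PMF.pure_apply, hb]

theorem expect_bind (p : PMF α) (g : α → PMF β) (f : β → ℝ≥0∞) :
    expect (p.bind g) f = expect p fun a => expect (g a) f := by
  simp only [expect, PMF.bind_apply, ← ENNReal.tsum_mul_right, ← ENNReal.tsum_mul_left]
  rw [ENNReal.tsum_comm]
  simp only [mul_assoc]

theorem expect_map (p : PMF α) (g : α → β) (f : β → ℝ≥0∞) :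
    expect (p.map g) f = expect p fun a => f (g a) := by
  rw [PMF.map, expect_bind]
  simp [expect_pure]

theorem expect_add (p : PMF α) (f g : α → ℝ≥0∞) :
    expect p (fun a => f a + g a) = expect p f + expect p g := by
  simp only [expect, mul_add, ENNReal.tsum_add]

theorem expect_const_mul (p : PMF α) (b : ℝ≥0∞) (f : α → ℝ≥0∞) :
    expect p (fun a => b * f a) = b * expect p f := by
  simp only [expect, ← ENNReal.tsum_mul_left]
  exact tsum_congr fun a => by ring

theorem expect_const (p : PMF α) (b : ℝ≥0∞) : expect p (fun _ => b) = b := by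
  simp only [expect, ENNReal.tsum_mul_right, p.tsum_coe, one_mul]

theorem expect_mono {p : PMF α} {f g : α → ℝ≥0∞} (h : ∀ a ∈ p.support, f a ≤ g a) :
    expect p f ≤ expect p g := by
  refine ENNReal.tsum_le_tsum fun a => ?_
  by_cases ha : p a = 0
  · simp [ha]
  · exact mul_le_mul_right (h a ((p.mem_support_iff a).2 ha)) _

theorem expect_congr {p : PMF α} {f g : α → ℝ≥0∞} (h : ∀ a ∈ p.support, f a = g a) :
    expect p f = expect p g :=
  le_antisymm (expect_mono fun a ha => (h a ha).le) (expect_mono fun a ha => (h a ha).ge)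

theorem bind_congr_support {p : PMF α} {f g : α → PMF β} (h : ∀ a ∈ p.support, f a = g a) :
    p.bind f = p.bind g := by
  ext b
  rw [PMF.bind_apply, PMF.bind_apply]
  exact expect_congr fun a ha => by rw [h a ha]

open Classical in
theorem toOuterMeasure_eq_expect (p : PMF α) (S : Set α) :
    p.toOuterMeasure S = expect p fun a => if a ∈ S then 1 else 0 := by
  rw [PMF.toOuterMeasure_apply, expect]
  refine tsum_congr fun a => ?_
  by_cases h : a ∈ S <;> simp [h]

theorem expect_indicator_singleton [DecidableEq α] (p : PMF α) (b : α) :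
    (expect p fun a => if a = b then 1 else 0) = p b := by
  rw [expect, tsum_eq_single b]
  · simp
  · intro a ha; simp [ha]

end Expectation

/-! ### Coupling machine runs with abstract random outcomes -/

section Simulation

variable {V : Type*} [Fintype V] [Nonempty V] (G : SimpleGraph V) [DecidableRel G.Adj]
  (nbr : (v : V) → Fin (G.degree v) ≃ G.neighborSet v) (W : ℕ)

/-- The law of the configuration after `t` steps from `c`. -/
noncomputable def lawFrom (c : Config V) : ℕ → PMF (Config V)
  | 0 => PMF.pure c
  | t + 1 => (lawFrom c t).bind (step G nbr W)

theorem law_eq_lawFrom (prog : Cmd) (input : List ℕ) (t : ℕ) :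
    law G nbr W prog input t = lawFrom G nbr W (init W prog input) t := by
  induction t with
  | zero => rfl
  | succ t ih => rw [law, lawFrom, ih]

/-- `lawFrom` appends steps at the end, whereas `Simulates` unfolds a run from its first step; the
Markov property reconciles the two. -/
theorem lawFrom_succ (c : Config V) (t : ℕ) :
    lawFrom G nbr W c (t + 1) = (step G nbr W c).bind fun c' => lawFrom G nbr W c' t := by
  induction t with
  | zero => simp [lawFrom]
  | succ t ih =>
    rw [lawFrom, ih, PMF.bind_bind]
    rfl

theorem step_halted {c : Config V} (h : c.Halted) : step G nbr W c = PMF.pure c := by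
  rw [Config.Halted] at h
  simp [step, h]

theorem lawFrom_halted {c : Config V} (h : c.Halted) (t : ℕ) :
    lawFrom G nbr W c t = PMF.pure c := by
  induction t with
  | zero => rfl
  | succ t ih => rw [lawFrom, ih, PMF.pure_bind, step_halted G nbr W h]

variable {Ω Ω' : Type*}

/-- Within `k` steps, a run from `c` reaches a configuration `c'` and is assigned an outcome `ω` of
law `p` such that `R ω c'`. -/
inductive Simulates (R : Ω → Config V → Prop) : ℕ → Config V → PMF Ω → Prop
  | done (k : ℕ) (c : Config V) (ω : Ω) (h : R ω c) : Simulates R k c (PMF.pure ω)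
  | det (k : ℕ) (c c' : Config V) (p : PMF Ω) (h : step G nbr W c = PMF.pure c')
      (hs : Simulates R k c' p) : Simulates R (k + 1) c p
  | randWord (k : ℕ) (c : Config V) (q : PMF ℕ) (g : ℕ → Config V) (f : ℕ → PMF Ω)
      (h : step G nbr W c = q.map g) (hs : ∀ r ∈ q.support, Simulates R k (g r) (f r)) :
      Simulates R (k + 1) c (q.bind f)
  | randVertex (k : ℕ) (c : Config V) (q : PMF V) (g : V → Config V) (f : V → PMF Ω)
      (h : step G nbr W c = q.map g) (hs : ∀ r ∈ q.support, Simulates R k (g r) (f r)) :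
      Simulates R (k + 1) c (q.bind f)

variable {G nbr W}

theorem Simulates.mono {R : Ω → Config V → Prop} {k k' : ℕ} {c : Config V} {p : PMF Ω}
    (h : Simulates G nbr W R k c p) (hk : k ≤ k') : Simulates G nbr W R k' c p := by
  induction h generalizing k' with
  | done k c ω h => exact .done _ _ _ h
  | det k c c' p h hs ih =>
    obtain ⟨j, rfl⟩ : ∃ j, k' = j + 1 := ⟨k' - 1, by omega⟩
    exact .det _ _ _ _ h (ih (by omega))
  | randWord k c q g f h hs ih =>
    obtain ⟨j, rfl⟩ : ∃ j, k' = j + 1 := ⟨k' - 1, by omega⟩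
    exact .randWord _ _ _ _ _ h fun r hr => ih r hr (by omega)
  | randVertex k c q g f h hs ih =>
    obtain ⟨j, rfl⟩ : ∃ j, k' = j + 1 := ⟨k' - 1, by omega⟩
    exact .randVertex _ _ _ _ _ h fun r hr => ih r hr (by omega)

/-- Sequential composition: `R` serves as the postcondition of the first block and the precondition
of the second, and step bounds add. -/
theorem Simulates.bind {R : Ω → Config V → Prop} {R' : Ω' → Config V → Prop} {k k' : ℕ}
    {c : Config V} {p : PMF Ω} {f : Ω → PMF Ω'} (h : Simulates G nbr W R k c p)
    (hf : ∀ ω c', R ω c' → Simulates G nbr W R' k' c' (f ω)) :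
    Simulates G nbr W R' (k + k') c (p.bind f) := by
  induction h with
  | done k c ω h =>
    rw [PMF.pure_bind]
    exact (hf ω c h).mono (by omega)
  | det k c c' p h hs ih =>
    rw [Nat.add_right_comm]
    exact .det _ _ _ _ h ih
  | randWord k c q g f h hs ih =>
    rw [Nat.add_right_comm, PMF.bind_bind]
    exact .randWord _ _ _ _ _ h ih
  | randVertex k c q g f h hs ih =>
    rw [Nat.add_right_comm, PMF.bind_bind]
    exact .randVertex _ _ _ _ _ h ih

theorem exists_coupling_of_random_step {α : Type*} {R : Ω → Config V → Prop} {k : ℕ}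
    {c : Config V} {q : PMF α} {g : α → Config V} {f : α → PMF Ω}
    (h : step G nbr W c = q.map g)
    (hs : ∀ r ∈ q.support, ∃ μ : PMF (Ω × Config V), μ.map Prod.fst = f r ∧
      (∀ x ∈ μ.support, R x.1 x.2) ∧ ∀ t, k ≤ t → lawFrom G nbr W (g r) t = μ.map Prod.snd) :
    ∃ μ : PMF (Ω × Config V), μ.map Prod.fst = q.bind f ∧ (∀ x ∈ μ.support, R x.1 x.2) ∧
      ∀ t, k + 1 ≤ t → lawFrom G nbr W c t = μ.map Prod.snd := by
  have key : ∀ r, ∃ μ : PMF (Ω × Config V), r ∈ q.support → (μ.map Prod.fst = f r ∧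
      (∀ x ∈ μ.support, R x.1 x.2) ∧
      ∀ t, k ≤ t → lawFrom G nbr W (g r) t = μ.map Prod.snd) := by
    intro r
    by_cases hr : r ∈ q.support
    · obtain ⟨μ, hμ⟩ := hs r hr
      exact ⟨μ, fun _ => hμ⟩
    · obtain ⟨r', hr'⟩ := q.support_nonempty
      obtain ⟨μ, -⟩ := hs r' hr'
      exact ⟨μ, fun h => absurd h hr⟩
  choose μ hμ using key
  refine ⟨q.bind μ, ?_, ?_, ?_⟩
  · rw [PMF.map_bind]
    exact bind_congr_support fun r hr => (hμ r hr).1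
  · intro x hx
    obtain ⟨r, hr, hx⟩ := (PMF.mem_support_bind_iff _ _ _).1 hx
    exact (hμ r hr).2.1 x hx
  · intro t ht
    obtain ⟨j, rfl⟩ : ∃ j, t = j + 1 := ⟨t - 1, by omega⟩
    rw [lawFrom_succ, h, PMF.bind_map, PMF.map_bind]
    exact bind_congr_support fun r hr => (hμ r hr).2.2 j (by omega)

/-- If `R` forces halting, the configuration is frozen from time `k` on, so one joint law of outcome
and final configuration serves all later times. -/
theorem Simulates.exists_coupling {R : Ω → Config V → Prop} {k : ℕ} {c : Config V} {p : PMF Ω}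
    (h : Simulates G nbr W R k c p) (hR : ∀ ω c', R ω c' → c'.Halted) :
    ∃ μ : PMF (Ω × Config V), μ.map Prod.fst = p ∧ (∀ x ∈ μ.support, R x.1 x.2) ∧
      ∀ t, k ≤ t → lawFrom G nbr W c t = μ.map Prod.snd := by
  induction h with
  | done k c ω h =>
    refine ⟨PMF.pure (ω, c), by simp [PMF.pure_map], ?_, ?_⟩
    · intro x hx
      obtain rfl := (PMF.mem_support_pure_iff _ _).1 hx
      exact h
    · intro t _
      rw [lawFrom_halted G nbr W (hR _ _ h), PMF.pure_map]
  | det k c c' p h hs ih =>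
    obtain ⟨μ, h1, h2, h3⟩ := ih
    refine ⟨μ, h1, h2, fun t ht => ?_⟩
    obtain ⟨j, rfl⟩ : ∃ j, t = j + 1 := ⟨t - 1, by omega⟩
    rw [lawFrom_succ, h, PMF.pure_bind, h3 j (by omega)]
  | randWord k c q g f h hs ih => exact exists_coupling_of_random_step h ih
  | randVertex k c q g f h hs ih => exact exists_coupling_of_random_step h ih

section Rules

variable {R : Ω → Config V → Prop} {k : ℕ} {p : PMF Ω} {rest : List Cmd} {mem : ℕ → ℕ}
  {vtx : ℕ → Option V} {res : Option (V × V)} {q t : ℕ}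

theorem Simulates.assign {a e : Expr} {x y : ℕ} (ha : a.eval W mem = x) (he : e.eval W mem = y)
    (h : Simulates G nbr W R k ⟨rest, Function.update mem x y, vtx, res, q, t + 1⟩ p) :
    Simulates G nbr W R (k + 1) ⟨.assign a e :: rest, mem, vtx, res, q, t⟩ p := by
  subst ha he
  exact .det _ _ _ _ rfl h

theorem Simulates.random {a e : Expr} {x y : ℕ} {f : ℕ → PMF Ω} (ha : a.eval W mem = x)
    (he : e.eval W mem = y)
    (h : ∀ r ∈ (uniformUpTo y).support,
      Simulates G nbr W R k ⟨rest, Function.update mem x r, vtx, res, q, t + 1⟩ (f r)) :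
    Simulates G nbr W R (k + 1) ⟨.random a e :: rest, mem, vtx, res, q, t⟩
      ((uniformUpTo y).bind f) := by
  subst ha he
  exact .randWord _ _ _ _ _ rfl h

theorem Simulates.vertexQuery {a : Expr} {x : ℕ} {f : V → PMF Ω} (ha : a.eval W mem = x)
    (h : ∀ v, Simulates G nbr W R k
      ⟨rest, mem, Function.update vtx x (some v), res, q + 1, t + 1⟩ (f v)) :
    Simulates G nbr W R (k + 1) ⟨.vertexQuery a :: rest, mem, vtx, res, q, t⟩
      ((PMF.uniformOfFintype V).bind f) := by
  classical
  subst ha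
  refine .randVertex _ _ (PMF.uniformOfFintype V) _ _ ?_ fun v _ => h v
  rfl

theorem Simulates.degreeQuery {a b : Expr} {x y d : ℕ} (ha : a.eval W mem = x)
    (hb : b.eval W mem = y) (hd : degreeAnswer G (vtx y) % W = d)
    (h : Simulates G nbr W R k ⟨rest, Function.update mem x d, vtx, res, q + 1, t + 1⟩ p) :
    Simulates G nbr W R (k + 1) ⟨.degreeQuery a b :: rest, mem, vtx, res, q, t⟩ p := by
  subst ha hb hd
  exact .det _ _ _ _ rfl h

theorem Simulates.neighborQuery {a b i : Expr} {x y j : ℕ} {o : Option V}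
    (ha : a.eval W mem = x) (hb : b.eval W mem = y) (hi : i.eval W mem = j)
    (ho : neighborAnswer G nbr (vtx y) j = o)
    (h : Simulates G nbr W R k ⟨rest, mem, Function.update vtx x o, res, q + 1, t + 1⟩ p) :
    Simulates G nbr W R (k + 1) ⟨.neighborQuery a b i :: rest, mem, vtx, res, q, t⟩ p := by
  subst ha hb hi ho
  exact .det _ _ _ _ rfl h

theorem Simulates.seq {s s' : Cmd}
    (h : Simulates G nbr W R k ⟨s :: s' :: rest, mem, vtx, res, q, t + 1⟩ p) :
    Simulates G nbr W R (k + 1) ⟨.seq s s' :: rest, mem, vtx, res, q, t⟩ p :=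
  .det _ _ _ _ rfl h

theorem Simulates.condTrue {b : Test} {s s' : Cmd} (hb : b.Holds W mem vtx)
    (h : Simulates G nbr W R k ⟨s :: rest, mem, vtx, res, q, t + 1⟩ p) :
    Simulates G nbr W R (k + 1) ⟨.cond b s s' :: rest, mem, vtx, res, q, t⟩ p :=
  .det _ _ _ _ (by simp [step, exec, hb]) h

theorem Simulates.condFalse {b : Test} {s s' : Cmd} (hb : ¬ b.Holds W mem vtx)
    (h : Simulates G nbr W R k ⟨s' :: rest, mem, vtx, res, q, t + 1⟩ p) :
    Simulates G nbr W R (k + 1) ⟨.cond b s s' :: rest, mem, vtx, res, q, t⟩ p :=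
  .det _ _ _ _ (by simp [step, exec, hb]) h

theorem Simulates.loopTrue {b : Test} {s : Cmd} (hb : b.Holds W mem vtx)
    (h : Simulates G nbr W R k ⟨s :: .loop b s :: rest, mem, vtx, res, q, t + 1⟩ p) :
    Simulates G nbr W R (k + 1) ⟨.loop b s :: rest, mem, vtx, res, q, t⟩ p :=
  .det _ _ _ _ (by simp [step, exec, hb]) h

theorem Simulates.loopFalse {b : Test} {s : Cmd} (hb : ¬ b.Holds W mem vtx)
    (h : Simulates G nbr W R k ⟨rest, mem, vtx, res, q, t + 1⟩ p) :
    Simulates G nbr W R (k + 1) ⟨.loop b s :: rest, mem, vtx, res, q, t⟩ p :=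
  .det _ _ _ _ (by simp [step, exec, hb]) h

theorem Simulates.ret {a b : Expr} {x y : ℕ} {u v : V} {ω : Ω} (ha : a.eval W mem = x)
    (hb : b.eval W mem = y) (hu : vtx x = some u) (hv : vtx y = some v)
    (h : R ω ⟨[], mem, vtx, some (u, v), q, t + 1⟩) :
    Simulates G nbr W R (k + 1) ⟨.ret a b :: rest, mem, vtx, res, q, t⟩ (PMF.pure ω) := by
  subst ha hb
  exact .det _ _ _ _ (by simp [step, exec, hu, hv]) (.done _ _ _ h)

theorem Simulates.fail {ω : Ω} (h : R ω ⟨[], mem, vtx, none, q, t + 1⟩) :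
    Simulates G nbr W R (k + 1) ⟨.fail :: rest, mem, vtx, res, q, t⟩ (PMF.pure ω) :=
  .det _ _ _ _ rfl (.done _ _ _ h)

end Rules

end Simulation

/-! ### The sampling program -/

section Program

/-- The content of the fixed cell `i`. -/
abbrev Expr.cell (i : ℕ) : Expr := .get (.lit i)

/-- A command without effect on the cells that the program reads. -/
def Cmd.skip : Cmd := .assign (.lit 8) (.lit 0)

/-- Return a uniformly random edge at the vertex in cell `1` if that vertex is heavy. -/
def heavyCmd : Cmd :=
  .seq (.degreeQuery (.lit 7) (.lit 1)) <|
    .cond (.le (.cell 7) (.cell 6)) .skip <|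
      .seq (.random (.lit 8) (.cell 7)) <|
        .seq (.neighborQuery (.lit 2) (.lit 1) (.cell 8)) (.ret (.lit 1) (.lit 2))

/-- One attempt to sample an edge, with the degree threshold in cell `6`. -/
def trialCmd : Cmd :=
  .seq (.vertexQuery (.lit 0)) <|
    .seq (.degreeQuery (.lit 7) (.lit 0)) <|
      .cond (.le (.cell 7) (.cell 6))
        (.seq (.random (.lit 8) (.cell 6)) <|
          .seq (.neighborQuery (.lit 1) (.lit 0) (.cell 8)) <|
            .cond (.isVertex (.lit 1))
              -- A fair coin: the drawn value is `1` or `2`.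
              (.seq (.random (.lit 8) (.lit 2)) <|
                .cond (.le (.cell 8) (.lit 1)) (.ret (.lit 0) (.lit 1)) heavyCmd)
              .skip)
        .skip

/-- Attempts with the decreasing thresholds `K / t`, where `K` is in cell `5` and `t` in cell `4`. -/
def searchCmd : Cmd :=
  .loop (.le (.cell 4) (.cell 5)) <|
    .seq (.assign (.lit 6) (.div (.cell 5) (.cell 4))) <|
      .seq (.assign (.lit 4) (.add (.cell 4) (.lit 1))) trialCmd

/-- Computes the binary logarithm of `n`, rounded up, in cell `3`. -/
def clogCmd : Cmd :=
  .loop (.le (.add (.cell 2) (.lit 1)) (.cell 0)) <|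
    .seq (.assign (.lit 2) (.add (.cell 2) (.cell 2))) <|
      -- The answer to this query is never used; the query pays for the steps of the iteration,
      -- keeping time linear in queries.
      .seq (.assign (.lit 3) (.add (.cell 3) (.lit 1))) (.vertexQuery (.lit 0))

/-- The edge sampling program. -/
def sampler : Cmd :=
  .seq (.assign (.lit 2) (.lit 1)) <|
    .seq clogCmd <|
      -- Cells `0`, `1` and `3` hold `n`, `N` and `⌈log₂ n⌉`. Since the last index is `2n` times the
      -- first, the thresholds run from `2n` down to `1`.
      .seq (.assign (.lit 4) (.mul (.lit 8192) (.mul (.cell 1) (.cell 3)))) <|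
        .seq (.assign (.lit 5) (.mul (.lit 2) (.mul (.cell 0) (.cell 4)))) <|
          .seq searchCmd .fail

/-- The index of the first attempt. -/
def firstTrial (n N : ℕ) : ℕ := 8192 * (N * Nat.clog 2 n)

/-- The index of the last attempt. -/
def lastTrial (n N : ℕ) : ℕ := 2 * (n * firstTrial n N)

end Program

/-! ### The abstract random process -/

section Abstract

variable {V : Type*} [Fintype V] [Nonempty V] (G : SimpleGraph V) [DecidableRel G.Adj]
  (nbr : (v : V) → Fin (G.degree v) ≃ G.neighborSet v)

/-- A random edge at `v` if `v` is heavy. -/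
noncomputable def heavyTrial (θ : ℕ) (v : V) : PMF (Option (V × V)) :=
  if G.degree v ≤ θ then PMF.pure none
  else (uniformUpTo (G.degree v)).bind fun j =>
    PMF.pure ((neighborAnswer G nbr (some v) j).map fun w => (v, w))

/-- The law of the outcome of an attempt with degree threshold `θ`. -/
noncomputable def trial (θ : ℕ) : PMF (Option (V × V)) :=
  (PMF.uniformOfFintype V).bind fun u =>
    if G.degree u ≤ θ then
      (uniformUpTo θ).bind fun i =>
        (neighborAnswer G nbr (some u) i).elim (PMF.pure none) fun v =>
          (uniformUpTo 2).bind fun b =>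
            if b ≤ 1 then PMF.pure (some (u, v)) else heavyTrial G nbr θ v
    else PMF.pure none

/-- Repeats attempts `tr t, tr (t + 1), …` until one succeeds, at most `f` times. The outcome is the
result and the number of attempts. -/
noncomputable def repeatTrials {E : Type*} (tr : ℕ → PMF (Option E)) :
    ℕ → ℕ → PMF (Option E × ℕ)
  | 0, _ => PMF.pure (none, 0)
  | f + 1, t => (tr t).bind fun o =>
      o.elim ((repeatTrials tr f (t + 1)).map fun x => (x.1, x.2 + 1)) fun e => PMF.pure (some e, 1)

end Abstract

/-! ### The program realizes the abstract process -/

section Simulation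

variable {V : Type*} [Fintype V] [Nonempty V] {G : SimpleGraph V} [DecidableRel G.Adj]
  {nbr : (v : V) → Fin (G.degree v) ≃ G.neighborSet v} {W : ℕ}

theorem eval_lit_of_lt {k : ℕ} {mem : ℕ → ℕ} (h : k < W) : (Expr.lit k).eval W mem = k :=
  Nat.mod_eq_of_lt h

theorem eval_cell_of_lt {k : ℕ} {mem : ℕ → ℕ} (h : k < W) : (Expr.cell k).eval W mem = mem k := by
  rw [Expr.cell, Expr.eval, eval_lit_of_lt h]

theorem mem_support_uniformUpTo {k r : ℕ} (hk : 0 < k) (h : r ∈ (uniformUpTo k).support) :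
    1 ≤ r ∧ r ≤ k := by
  have hne : (Finset.Icc 1 k).Nonempty := ⟨1, by simp; omega⟩
  rw [uniformUpTo, dif_pos hne, PMF.mem_support_uniformOfFinset_iff] at h
  exact Finset.mem_Icc.1 h

/-- The relation between the outcome of an attempt and the configuration reached by it. -/
def TrialDone (rest : List Cmd) (mem : ℕ → ℕ) (q t : ℕ) (o : Option (V × V)) (c : Config V) :
    Prop :=
  c.result = o ∧ q + 1 ≤ c.queries ∧ c.queries ≤ q + 5 ∧ c.time ≤ t + 30 ∧
    (o.isSome → c.Halted) ∧
    (o = none → c.code = rest ∧ ∀ i, i ≤ 6 → c.mem i = mem i)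

/-- The bounds on `q` and `t` are what the enclosing attempt has spent so far, so that the budget of
`TrialDone` for a whole attempt can be checked here. Only cells `7` and `8` are overwritten. -/
theorem simulates_heavyCmd {rest : List Cmd} {mem mem₀ : ℕ → ℕ} {vtx : ℕ → Option V}
    {q t q₀ t₀ : ℕ} {v : V} (hW : 8192 < W) (hd : ∀ v, G.degree v < W) (hv : vtx 1 = some v)
    (hmem : ∀ i, i ≤ 6 → mem i = mem₀ i) (hq₀ : q₀ + 1 ≤ q) (hq : q ≤ q₀ + 3)
    (ht : t ≤ t₀ + 15) :
    Simulates G nbr W (TrialDone rest mem₀ q₀ t₀) 10 ⟨heavyCmd :: rest, mem, vtx, none, q, t⟩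
      (heavyTrial G nbr (mem₀ 6) v) := by
  have lit : ∀ {k : ℕ} {mem : ℕ → ℕ}, k ≤ 8192 → (Expr.lit k).eval W mem = k :=
    fun h => eval_lit_of_lt (by omega)
  have cell : ∀ {k : ℕ} {mem : ℕ → ℕ}, k ≤ 8192 → (Expr.cell k).eval W mem = mem k :=
    fun h => eval_cell_of_lt (by omega)
  have h6 := hmem 6 le_rfl
  refine .seq <| .degreeQuery (lit (by norm_num)) (lit (by norm_num))
    (d := G.degree v) (by rw [hv]; exact Nat.mod_eq_of_lt (hd v)) ?_
  have hmem' : ∀ i, i ≤ 6 → Function.update mem 7 (G.degree v) i = mem₀ i := fun i hi => by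
    rw [Function.update_of_ne (by omega), hmem i hi]
  by_cases hle : G.degree v ≤ mem₀ 6
  · rw [heavyTrial, if_pos hle]
    refine .condTrue ?_ <| .assign (lit (by norm_num)) rfl <| .done _ _ _ ?_
    · rw [Test.Holds, cell (by norm_num), cell (by norm_num), hmem' 6 le_rfl]
      simpa using hle
    · refine ⟨rfl, by simp; omega, by simp; omega, by simp; omega, by simp, fun _ => ⟨rfl, ?_⟩⟩
      intro i hi
      dsimp only
      rw [Function.update_of_ne (by omega), hmem' i hi]
  · rw [heavyTrial, if_neg hle]
    refine .condFalse ?_ <| .seq <| .random (lit (by norm_num))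
      (by rw [cell (by norm_num), Function.update_self]) fun j hj => ?_
    · rw [Test.Holds, cell (by norm_num), cell (by norm_num), hmem' 6 le_rfl]
      simpa using hle
    · have hj := mem_support_uniformUpTo (by omega) hj
      have hw : neighborAnswer G nbr (some v) j = some ↑(nbr v ⟨j - 1, by omega⟩) := by
        rw [neighborAnswer, dif_pos hj]
      refine .seq <| .neighborQuery (lit (by norm_num)) (lit (by norm_num))
        (by rw [cell (by norm_num), Function.update_self]) (by rw [hv]) ?_
      rw [hw]
      refine .ret (lit (by norm_num)) (lit (by norm_num))
        (by rw [Function.update_of_ne (by norm_num)]; exact hv) (Function.update_self ..) ?_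
      refine ⟨rfl, by simp; omega, by simp; omega, by simp; omega, fun _ => rfl, by simp⟩

theorem simulates_trialCmd {rest : List Cmd} {mem : ℕ → ℕ} {vtx : ℕ → Option V} {q t : ℕ}
    (hW : 8192 < W) (hd : ∀ v, G.degree v < W) :
    Simulates G nbr W (TrialDone rest mem q t) 25 ⟨trialCmd :: rest, mem, vtx, none, q, t⟩
      (trial G nbr (mem 6)) := by
  have lit : ∀ {k : ℕ} {mem : ℕ → ℕ}, k ≤ 8192 → (Expr.lit k).eval W mem = k :=
    fun h => eval_lit_of_lt (by omega)
  have cell : ∀ {k : ℕ} {mem : ℕ → ℕ}, k ≤ 8192 → (Expr.cell k).eval W mem = mem k :=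
    fun h => eval_cell_of_lt (by omega)
  refine .seq <| .vertexQuery (lit (by norm_num)) fun u => ?_
  refine .seq <| .degreeQuery (lit (by norm_num)) (lit (by norm_num))
    (d := G.degree u) (by rw [Function.update_self]; exact Nat.mod_eq_of_lt (hd u)) ?_
  have hmem₁ : ∀ i, i ≤ 6 → Function.update mem 7 (G.degree u) i = mem i := fun i hi => by
    rw [Function.update_of_ne (by omega)]
  by_cases hle : G.degree u ≤ mem 6
  · rw [if_pos hle]
    refine .condTrue ?_ <| .seq <| .random (lit (by norm_num))
      (by rw [cell (by norm_num), hmem₁ 6 le_rfl]) fun i _ => ?_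
    · rw [Test.Holds, cell (by norm_num), cell (by norm_num), hmem₁ 6 le_rfl]
      simpa using hle
    have hmem₂ : ∀ j, j ≤ 6 →
        Function.update (Function.update mem 7 (G.degree u)) 8 i j = mem j := fun j hj => by
      rw [Function.update_of_ne (by omega), hmem₁ j hj]
    refine .seq <| .neighborQuery (lit (by norm_num)) (lit (by norm_num))
      (by rw [cell (by norm_num), Function.update_self]) (by rw [Function.update_self]) ?_
    rcases hv : neighborAnswer G nbr (some u) i with _ | v
    · refine .condFalse (by simp [Test.Holds, lit]) <| .assign (lit (by norm_num)) rfl <|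
        .done _ _ _ ?_
      refine ⟨rfl, by simp, by simp, by simp, by simp, fun _ => ⟨rfl, ?_⟩⟩
      intro j hj
      dsimp only
      rw [Function.update_of_ne (by omega), hmem₂ j hj]
    · refine .condTrue (by simp [Test.Holds, lit]) <| .seq <| .random (lit (by norm_num))
        (lit (by norm_num)) fun b _ => ?_
      by_cases hb : b ≤ 1
      · rw [if_pos hb]
        refine .condTrue ?_ <| .ret (lit (by norm_num)) (lit (by norm_num))
          (by rw [Function.update_of_ne (by norm_num), Function.update_self])
          (Function.update_self ..) ?_
        · rw [Test.Holds, cell (by norm_num), lit (by norm_num), Function.update_self]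
          exact hb
        · exact ⟨rfl, by simp, by simp, by simp, fun _ => rfl, by simp⟩
      · rw [if_neg hb]
        refine .condFalse ?_ <| (simulates_heavyCmd hW hd (Function.update_self ..) ?_ ?_ ?_ ?_).mono
          (by norm_num)
        · rw [Test.Holds, cell (by norm_num), lit (by norm_num), Function.update_self]
          exact hb
        · intro j hj
          rw [Function.update_of_ne (by omega), hmem₂ j hj]
        all_goals omega
  · rw [if_neg hle]
    refine .condFalse ?_ <| .assign (lit (by norm_num)) rfl <| .done _ _ _ ?_
    · rw [Test.Holds, cell (by norm_num), cell (by norm_num), hmem₁ 6 le_rfl]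
      simpa using hle
    · refine ⟨rfl, by simp, by simp, by simp, by simp, fun _ => ⟨rfl, ?_⟩⟩
      intro i hi
      dsimp only
      rw [Function.update_of_ne (by omega), hmem₁ i hi]

/-- The relation between the outcome of the search and the final configuration. -/
def SearchDone (q t : ℕ) (ω : Option (V × V) × ℕ) (c : Config V) : Prop :=
  c.Halted ∧ c.result = ω.1 ∧ q + ω.2 ≤ c.queries ∧ c.queries ≤ q + 5 * ω.2 ∧
    c.time + 35 * q ≤ t + 35 * c.queries + 2

/-- An iteration costs at most `30` steps for the attempt and `5` for the loop, and makes at least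
one query; hence the rate `35` in `SearchDone`. The counter ends at `mem 5 + 1`, which must still
fit in a word. -/
theorem simulates_searchCmd {mem : ℕ → ℕ} {vtx : ℕ → Option V} {q t f : ℕ} (hW : 8192 < W)
    (hd : ∀ v, G.degree v < W) (hK : mem 5 + 1 < W) (hf : mem 4 + f = mem 5 + 1) :
    Simulates G nbr W (SearchDone q t) (30 * f + 2)
      ⟨[searchCmd, .fail], mem, vtx, none, q, t⟩
      (repeatTrials (fun i => trial G nbr (mem 5 / i)) f (mem 4)) := by
  have lit : ∀ {k : ℕ} {mem : ℕ → ℕ}, k ≤ 8192 → (Expr.lit k).eval W mem = k :=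
    fun h => eval_lit_of_lt (by omega)
  have cell : ∀ {k : ℕ} {mem : ℕ → ℕ}, k ≤ 8192 → (Expr.cell k).eval W mem = mem k :=
    fun h => eval_cell_of_lt (by omega)
  induction f generalizing mem vtx q t with
  | zero =>
    refine .loopFalse ?_ <| .fail ⟨rfl, rfl, by simp, by simp, by dsimp only; omega⟩
    rw [Test.Holds, cell (by norm_num), cell (by norm_num)]
    omega
  | succ f ih =>
    rw [show 30 * (f + 1) + 2 = 30 * f + 2 + 25 + 5 by ring]
    refine .loopTrue ?_ <| .seq <| .assign (lit (by norm_num)) rfl <| .seq <|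
      .assign (lit (by norm_num)) rfl ?_
    · rw [Test.Holds, cell (by norm_num), cell (by norm_num)]
      omega
    have hθ : (Expr.div (.cell 5) (.cell 4)).eval W mem = mem 5 / mem 4 := by
      rw [Expr.eval, cell (by norm_num), cell (by norm_num)]
    rw [hθ]
    have h4 : (Expr.add (.cell 4) (.lit 1)).eval W (Function.update mem 6 (mem 5 / mem 4)) =
        mem 4 + 1 := by
      rw [Expr.eval, cell (by norm_num), lit (by norm_num), Function.update_of_ne (by norm_num),
        Nat.mod_eq_of_lt (by omega)]
    rw [h4]
    set mem' := Function.update (Function.update mem 6 (mem 5 / mem 4)) 4 (mem 4 + 1) with hmem'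
    have e4 : mem' 4 = mem 4 + 1 := by simp [hmem']
    have e5 : mem' 5 = mem 5 := by simp [hmem']
    have e6 : mem' 6 = mem 5 / mem 4 := by simp [hmem']
    rw [show 30 * f + 2 + 25 = 25 + (30 * f + 2) by ring, repeatTrials]
    rw [← e6]
    refine (simulates_trialCmd hW hd).bind ?_
    rintro (_ | e) ⟨code, mem₁, vtx₁, res₁, q₁, t₁⟩ ⟨h1, h2, h3, h4, h5, h6⟩ <;>
      dsimp only at h1 h2 h3 h4 h5 h6
    · obtain ⟨h6, h7⟩ := h6 rfl
      subst h1 h6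
      have := ih (mem := mem₁) (vtx := vtx₁) (q := q₁) (t := t₁)
        (by rw [h7 5 (by norm_num), e5]; exact hK)
        (by rw [h7 4 (by norm_num), h7 5 (by norm_num), e4, e5]; omega)
      rw [h7 4 (by norm_num), h7 5 (by norm_num), e4, e5] at this
      -- A zero-step continuation that only relabels the outcome, counting the failed attempt.
      have := this.bind (R' := SearchDone q t) (k' := 0)
        (f := fun x => PMF.pure (x.1, x.2 + 1)) ?_
      · exact this
      · rintro ω c ⟨g1, g2, g3, g4, g5⟩
        exact .done _ _ _ ⟨g1, g2, by simp; omega, by simp; omega, by omega⟩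
    · subst h1
      exact .done _ _ _ ⟨h5 rfl, rfl, by simp; omega, by simp; omega, by simp; omega⟩

/-- The state of the machine when the logarithm has been computed. -/
def ClogDone (rest : List Cmd) (n N q t j : ℕ) (_ : Unit) (c : Config V) : Prop :=
  c.code = rest ∧ c.mem 0 = n ∧ c.mem 1 = N ∧ c.mem 3 = Nat.clog 2 n ∧ c.result = none ∧
    c.queries = q + j ∧ c.time ≤ t + 6 * j + 1

theorem simulates_clogCmd {rest : List Cmd} {n N : ℕ} {mem : ℕ → ℕ} {vtx : ℕ → Option V}
    {q t i j : ℕ} (hW : 8192 < W) (hn : 2 * n + 2 < W) (hn₁ : 1 < n) (h0 : mem 0 = n)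
    (h1 : mem 1 = N) (h2 : mem 2 = 2 ^ i) (h3 : mem 3 = i) (hj : i + j = Nat.clog 2 n) :
    Simulates G nbr W (ClogDone rest n N q t j) (6 * j + 1)
      ⟨clogCmd :: rest, mem, vtx, none, q, t⟩ (PMF.pure ()) := by
  have lit : ∀ {k : ℕ} {mem : ℕ → ℕ}, k ≤ 8192 → (Expr.lit k).eval W mem = k :=
    fun h => eval_lit_of_lt (by omega)
  have cell : ∀ {k : ℕ} {mem : ℕ → ℕ}, k ≤ 8192 → (Expr.cell k).eval W mem = mem k :=
    fun h => eval_cell_of_lt (by omega)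
  have hlog : Nat.clog 2 n ≤ n := Nat.clog_le_of_le_pow Nat.lt_two_pow_self.le
  induction j generalizing mem vtx q t i with
  | zero =>
    have hle : n ≤ 2 ^ i := by
      rw [add_zero] at hj
      rw [hj]
      exact Nat.le_pow_clog (by norm_num) n
    -- The power of two overshoots `n` by less than a factor `2`, so the test `2 ^ i + 1 ≤ n` is
    -- evaluated without overflow.
    have hlt : 2 ^ i < 2 * n := by
      have := Nat.pow_pred_clog_lt_self (b := 2) (by norm_num) hn₁
      have hpos : 0 < Nat.clog 2 n := Nat.clog_pos (by norm_num) hn₁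
      rw [add_zero] at hj
      rw [← Nat.succ_pred_eq_of_pos hpos, Nat.succ_eq_add_one] at hj
      rw [hj, pow_succ]
      omega
    refine .loopFalse ?_ <| .done _ _ _ ⟨rfl, h0, h1, by dsimp only; omega, rfl, rfl, by simp⟩
    rw [Test.Holds, cell (by norm_num), Expr.eval, cell (by norm_num), lit (by norm_num), h0, h2,
      Nat.mod_eq_of_lt (by omega)]
    omega
  | succ j ih =>
    have hlt : 2 ^ i < n := (Nat.lt_clog_iff_pow_lt (by norm_num)).1 (by omega)
    rw [show 6 * (j + 1) + 1 = 6 * j + 1 + 6 by ring]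
    have e2 : (Expr.add (.cell 2) (.cell 2)).eval W mem = 2 ^ (i + 1) := by
      rw [Expr.eval, cell (by norm_num), h2, pow_succ, Nat.mod_eq_of_lt (by omega)]
      ring
    have e3 : (Expr.add (.cell 3) (.lit 1)).eval W (Function.update mem 2 (2 ^ (i + 1))) =
        i + 1 := by
      rw [Expr.eval, cell (by norm_num), lit (by norm_num), Function.update_of_ne (by norm_num),
        h3, Nat.mod_eq_of_lt (by omega)]
    -- The outcome is deterministic, but the step is a random vertex query; its discarded answer is
    -- inserted into the law.
    rw [← PMF.bind_const (PMF.uniformOfFintype V) (PMF.pure ())]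
    refine .loopTrue ?_ <| .seq <| .assign (lit (by norm_num)) e2 <| .seq <|
      .assign (lit (by norm_num)) e3 <| .vertexQuery (lit (by norm_num)) fun v => ?_
    · rw [Test.Holds, cell (by norm_num), Expr.eval, cell (by norm_num), lit (by norm_num), h0, h2,
        Nat.mod_eq_of_lt (by omega)]
      omega
    · have := (ih (mem := Function.update (Function.update mem 2 (2 ^ (i + 1))) 3 (i + 1))
        (vtx := Function.update vtx 0 (some v)) (q := q + 1) (t := t + 1 + 1 + 1 + 1 + 1 + 1)
        (i := i + 1) (by simpa using h0) (by simpa using h1) (by simp) (by simp)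
        (by omega)).bind (k' := 0) (f := fun _ => PMF.pure ())
        (R' := ClogDone rest n N q t (j + 1)) ?_
      · rw [PMF.pure_bind] at this
        exact this
      · rintro - c ⟨g1, g2, g3, g4, g5, g6, g7⟩
        exact .done _ _ _ ⟨g1, g2, g3, g4, g5, by omega, by omega⟩

/-- The relation between the outcome of the sampler and the final configuration. -/
def SamplerDone (n : ℕ) (ω : Option (V × V) × ℕ) (c : Config V) : Prop :=
  c.Halted ∧ c.result = ω.1 ∧ c.queries ≤ Nat.clog 2 n + 5 * ω.2 ∧ c.time ≤ 55 * c.queries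

theorem simulates_sampler {n N : ℕ} (hd : ∀ v, G.degree v < W) (hn₁ : 1 < n) (hN : 1 ≤ N)
    (hK : lastTrial n N + 1 < W) :
    ∃ k, Simulates G nbr W (SamplerDone n) k (init W sampler [n, N])
      (repeatTrials (fun i => trial G nbr (lastTrial n N / i))
        (lastTrial n N + 1 - firstTrial n N) (firstTrial n N)) := by
  have hL : 0 < Nat.clog 2 n := Nat.clog_pos (by norm_num) hn₁
  set L := Nat.clog 2 n with hLdef
  have h1 : N ≤ N * L := Nat.le_mul_of_pos_right N hL
  have h1' : L ≤ N * L := Nat.le_mul_of_pos_left L hN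
  have h2 : firstTrial n N = 8192 * (N * L) := rfl
  have h3 : lastTrial n N = 2 * (n * firstTrial n N) := rfl
  have h4 : firstTrial n N ≤ n * firstTrial n N := Nat.le_mul_of_pos_left _ (by omega)
  have h4' : n ≤ n * firstTrial n N := Nat.le_mul_of_pos_right n (by omega)
  have hW : 8192 < W := by omega
  have hnW : 2 * n + 2 < W := by
    have : n * 8192 ≤ n * firstTrial n N := Nat.mul_le_mul_left n (by omega)
    omega
  have lit : ∀ {k : ℕ} {mem : ℕ → ℕ}, k ≤ 8192 → (Expr.lit k).eval W mem = k :=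
    fun h => eval_lit_of_lt (by omega)
  have cell : ∀ {k : ℕ} {mem : ℕ → ℕ}, k ≤ 8192 → (Expr.cell k).eval W mem = mem k :=
    fun h => eval_cell_of_lt (by omega)
  refine ⟨(6 * L + 1) + (30 * (lastTrial n N + 1 - firstTrial n N) + 2 + 5) + 3, ?_⟩
  rw [← PMF.pure_bind () (fun _ => repeatTrials (fun i => trial G nbr (lastTrial n N / i))
        (lastTrial n N + 1 - firstTrial n N) (firstTrial n N))]
  refine .seq <| .assign (lit (by norm_num)) (lit (by norm_num)) <| .seq <|
    (simulates_clogCmd (n := n) (N := N) (i := 0) (j := L) hW hnW hn₁ ?_ ?_ ?_ ?_ ?_).bind ?_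
  · simp [Nat.mod_eq_of_lt (show n < W by omega)]
  · simp [Nat.mod_eq_of_lt (show N < W by omega)]
  · simp
  · simp
  · omega
  rintro - ⟨code, mem, vtx, res, q, t⟩ ⟨g1, g2, g3, g4, g5, g6, g7⟩
  dsimp only at g1 g2 g3 g4 g5 g6 g7
  subst g1 g5
  refine .seq <| .assign (y := firstTrial n N) (lit (by norm_num)) ?_ <| .seq <|
    .assign (y := lastTrial n N) (lit (by norm_num)) ?_ <| .seq ?_
  · change (Expr.eval W mem (.lit 8192) *
      ((Expr.eval W mem (.cell 1) * Expr.eval W mem (.cell 3)) % W)) % W = _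
    rw [cell (by norm_num), cell (by norm_num), lit (by norm_num), g3, g4,
      Nat.mod_eq_of_lt (a := N * L) (by omega), Nat.mod_eq_of_lt (by omega), h2]
  · change (Expr.eval W _ (.lit 2) *
      ((Expr.eval W _ (.cell 0) * Expr.eval W _ (.cell 4)) % W)) % W = _
    rw [cell (by norm_num), cell (by norm_num), lit (by norm_num), Function.update_self, Function.update_of_ne (by norm_num), g2,
      Nat.mod_eq_of_lt (a := n * firstTrial n N) (by omega), Nat.mod_eq_of_lt (by omega), h3]
  set mem' := Function.update (Function.update mem 4 (firstTrial n N)) 5 (lastTrial n N) with hmem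
  have e4 : mem' 4 = firstTrial n N := by simp [hmem]
  have e5 : mem' 5 = lastTrial n N := by simp [hmem]
  have hs := (simulates_searchCmd (G := G) (nbr := nbr) (mem := mem') (vtx := vtx) (q := q)
    (t := t + 1 + 1 + 1 + 1 + 1)
    (f := lastTrial n N + 1 - firstTrial n N) hW hd (by rw [e5]; exact hK)
    (by rw [e4, e5]; omega)).bind (k' := 0) (f := PMF.pure) (R' := SamplerDone n) ?_
  · rw [PMF.bind_pure, e4, e5] at hs
    exact hs
  · rintro ω c ⟨k1, k2, k3, k4, k5⟩
    exact .done _ _ _ ⟨k1, k2, by omega, by omega⟩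

end Simulation

/-! ### The law of one attempt -/

section TrialLaw

variable {V : Type*} [Fintype V] [Nonempty V] (G : SimpleGraph V) [DecidableRel G.Adj]
  (nbr : (v : V) → Fin (G.degree v) ≃ G.neighborSet v)

theorem expect_uniformOfFintype (f : V → ℝ≥0∞) :
    expect (PMF.uniformOfFintype V) f = (Fintype.card V : ℝ≥0∞)⁻¹ * ∑ v, f v := by
  simp [expect, tsum_fintype, Finset.mul_sum]

theorem expect_uniformUpTo {k : ℕ} (hk : 0 < k) (f : ℕ → ℝ≥0∞) :
    expect (uniformUpTo k) f = (k : ℝ≥0∞)⁻¹ * ∑ i ∈ Finset.Icc 1 k, f i := by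
  have hne : (Finset.Icc 1 k).Nonempty := ⟨1, by simp; omega⟩
  rw [expect, uniformUpTo, dif_pos hne, Finset.mul_sum, tsum_eq_sum (s := Finset.Icc 1 k)]
  · refine Finset.sum_congr rfl fun i hi => ?_
    rw [PMF.uniformOfFinset_apply_of_mem _ hi]
    simp
  · intro i hi
    rw [PMF.uniformOfFinset_apply_of_notMem _ hi, zero_mul]

-- Indices up to the degree enumerate the neighbors once each; the indices beyond it fail and
-- contribute `f none = 0`. This is the rejection step that makes all edges at light vertices
-- equally likely.
omit [Nonempty V] in
theorem sum_neighborAnswer {k : ℕ} {v : V} (hk : G.degree v ≤ k) (f : Option V → ℝ≥0∞)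
    (hf : f none = 0) :
    ∑ i ∈ Finset.Icc 1 k, f (neighborAnswer G nbr (some v) i) =
      ∑ w ∈ G.neighborFinset v, f (some w) := by
  rw [← Finset.sum_subset (Finset.Icc_subset_Icc_right hk)]
  · rw [← Finset.sum_coe_sort, Finset.sum_subtype (G.neighborFinset v)
      (p := (· ∈ G.neighborSet v)) fun w => by simp]
    let e : (Finset.Icc 1 (G.degree v)) ≃ Fin (G.degree v) :=
      { toFun := fun i => ⟨i - 1, by have := Finset.mem_Icc.1 i.2; omega⟩
        invFun := fun j => ⟨j + 1, Finset.mem_Icc.2 (by omega)⟩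
        left_inv := fun i => by
          have := Finset.mem_Icc.1 i.2
          ext; simp; omega
        right_inv := fun j => by ext; simp }
    refine Fintype.sum_equiv (e.trans (nbr v)) _ _ ?_
    intro i
    rw [neighborAnswer, dif_pos (Finset.mem_Icc.1 i.2)]
    rfl
  · intro i hi hi'
    rw [neighborAnswer, dif_neg (by simpa using hi'), hf]

omit [Nonempty V] in
open Classical in
theorem heavyTrial_apply (θ : ℕ) (v x y : V) :
    heavyTrial G nbr θ v (some (x, y)) =
      if v = x ∧ θ < G.degree x ∧ G.Adj x y then (G.degree x : ℝ≥0∞)⁻¹ else 0 := by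
  rw [heavyTrial]
  by_cases hle : G.degree v ≤ θ
  · rw [if_pos hle, if_neg]
    · simp
    · rintro ⟨rfl, h, -⟩
      omega
  · rw [if_neg hle, ← expect_indicator_singleton, expect_bind, expect_uniformUpTo (by omega)]
    simp only [expect_pure]
    rw [sum_neighborAnswer G nbr le_rfl
      (fun o => if o.map (fun w => (v, w)) = some (x, y) then 1 else 0) (by simp)]
    simp only [Option.map_some, Option.some.injEq, Prod.mk.injEq]
    by_cases hv : v = x
    · subst hv
      have h : θ < G.degree v := by omega
      by_cases hy : G.Adj v y <;> simp [h, hy]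
    · simp [hv]

/-- The probability of a directed edge at `x` in an attempt, relative to that of a light edge. -/
noncomputable def edgeWeight (θ : ℕ) (x : V) : ℝ :=
  if G.degree x ≤ θ then 1
  else ((G.neighborFinset x).filter fun u => G.degree u ≤ θ).card / G.degree x

-- For light `x` only the draw `u = x`, `v = y` contributes. For heavy `x` that draw is rejected,
-- and the edge arises only by reaching `x` from a light neighbor and then picking `y`, with
-- probability `1/d(x)`.
open Classical in
theorem trial_apply {θ : ℕ} (hθ : 0 < θ) (x y : V) :
    (trial G nbr θ (some (x, y))).toReal =
      if G.Adj x y then edgeWeight G θ x / (2 * Fintype.card V * θ) else 0 := by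
  have key : trial G nbr θ (some (x, y)) = (Fintype.card V : ℝ≥0∞)⁻¹ * ∑ u,
      if G.degree u ≤ θ then (θ : ℝ≥0∞)⁻¹ * ∑ v ∈ G.neighborFinset u,
        (2 : ℝ≥0∞)⁻¹ * ((if u = x ∧ v = y then 1 else 0) +
          if v = x ∧ θ < G.degree x ∧ G.Adj x y then (G.degree x : ℝ≥0∞)⁻¹ else 0)
      else 0 := by
    rw [← expect_indicator_singleton, trial, expect_bind, expect_uniformOfFintype]
    congr 1
    refine Finset.sum_congr rfl fun u _ => ?_
    by_cases hu : G.degree u ≤ θ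
    · rw [if_pos hu, if_pos hu, expect_bind, expect_uniformUpTo hθ]
      congr 1
      rw [sum_neighborAnswer G nbr hu (fun o => expect (o.elim (PMF.pure none) fun v =>
          (uniformUpTo 2).bind fun b =>
            if b ≤ 1 then PMF.pure (some (u, v)) else heavyTrial G nbr θ v)
          fun a => if a = some (x, y) then 1 else 0) (by simp [expect_pure])]
      refine Finset.sum_congr rfl fun v _ => ?_
      rw [Option.elim_some, expect_bind, expect_uniformUpTo (by norm_num)]
      rw [show Finset.Icc 1 2 = {1, 2} by rfl, Finset.sum_pair (by norm_num)]
      rw [if_pos le_rfl, if_neg (by norm_num), expect_pure, expect_indicator_singleton,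
        heavyTrial_apply]
      simp
    · rw [if_neg hu, if_neg hu, expect_pure]
      simp
  rw [key]
  by_cases hxy : G.Adj x y
  · have hdx : 0 < G.degree x := (G.degree_pos_iff_exists_adj x).2 ⟨y, hxy⟩
    rw [if_pos hxy, edgeWeight]
    by_cases hx : G.degree x ≤ θ
    · rw [if_pos hx]
      have : ∀ u, (if G.degree u ≤ θ then (θ : ℝ≥0∞)⁻¹ * ∑ v ∈ G.neighborFinset u,
        (2 : ℝ≥0∞)⁻¹ * ((if u = x ∧ v = y then 1 else 0) +
          if v = x ∧ θ < G.degree x ∧ G.Adj x y then (G.degree x : ℝ≥0∞)⁻¹ else 0)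
          else 0) = if u = x then (θ : ℝ≥0∞)⁻¹ * (2 : ℝ≥0∞)⁻¹ else 0 := by
        intro u
        by_cases hu : u = x
        · subst hu
          simp [hx, hx.not_gt, hxy]
        · simp [hu, hx.not_gt]
      simp only [this]
      simp [ENNReal.toReal_mul, ENNReal.toReal_inv]
      ring
    · rw [if_neg hx]
      have : ∀ u, (if G.degree u ≤ θ then (θ : ℝ≥0∞)⁻¹ * ∑ v ∈ G.neighborFinset u,
        (2 : ℝ≥0∞)⁻¹ * ((if u = x ∧ v = y then 1 else 0) +
          if v = x ∧ θ < G.degree x ∧ G.Adj x y then (G.degree x : ℝ≥0∞)⁻¹ else 0)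
          else 0) = if u ∈ (G.neighborFinset x).filter fun u => G.degree u ≤ θ then
            (θ : ℝ≥0∞)⁻¹ * ((2 : ℝ≥0∞)⁻¹ * (G.degree x : ℝ≥0∞)⁻¹) else 0 := by
        intro u
        by_cases hu : G.degree u ≤ θ
        · have hux : u ≠ x := by rintro rfl; exact hx hu
          by_cases hadj : G.Adj x u
          · simp [hu, hux, hxy, not_le.1 hx, hadj, hadj.symm]
          · have hadj' : ¬ G.Adj u x := fun h => hadj h.symm
            simp [hu, hux, hxy, not_le.1 hx, hadj, hadj']
        · simp [hu]
      simp only [this]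
      rw [Finset.sum_ite_mem, Finset.univ_inter, Finset.sum_const, nsmul_eq_mul]
      simp [ENNReal.toReal_mul, ENNReal.toReal_inv]
      ring
  · rw [if_neg hxy]
    convert ENNReal.toReal_zero
    rw [mul_eq_zero]
    right
    refine Finset.sum_eq_zero fun u _ => ?_
    split_ifs with hu
    · rw [mul_eq_zero]
      right
      refine Finset.sum_eq_zero fun v hv => ?_
      rw [SimpleGraph.mem_neighborFinset] at hv
      rw [if_neg, if_neg]
      · simp
      · tauto
      · rintro ⟨rfl, rfl⟩
        exact hxy hv
    · rfl

omit [Nonempty V] in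
theorem edgeWeight_le_one (θ : ℕ) (x : V) : edgeWeight G θ x ≤ 1 := by
  rw [edgeWeight]
  split_ifs
  · rfl
  · refine div_le_one_of_le₀ ?_ (by positivity)
    rw [← SimpleGraph.card_neighborFinset_eq_degree]
    exact_mod_cast Finset.card_filter_le _ _

omit [Nonempty V] in
theorem card_heavy_mul_le (θ : ℕ) :
    (Finset.univ.filter fun u => ¬ G.degree u ≤ θ).card * θ ≤ ∑ v, G.degree v := by
  calc (Finset.univ.filter fun u => ¬ G.degree u ≤ θ).card * θ
      = ∑ _u ∈ Finset.univ.filter (fun u => ¬ G.degree u ≤ θ), θ := by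
        rw [Finset.sum_const, smul_eq_mul]
    _ ≤ ∑ u ∈ Finset.univ.filter (fun u => ¬ G.degree u ≤ θ), G.degree u :=
        Finset.sum_le_sum fun u hu => by
          have := (Finset.mem_filter.1 hu).2
          omega
    _ ≤ _ := Finset.sum_le_sum_of_subset (Finset.filter_subset _ _)

-- There are at most `m/θ ≤ ηθ` heavy vertices in all, while a heavy `x` has more than `θ`
-- neighbors, so less than a fraction `η` of them can be heavy. If `θ ≥ n`, no vertex is heavy.
omit [Nonempty V] in
theorem one_sub_le_edgeWeight {θ : ℕ} {η : ℝ} (hη : 0 ≤ η)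
    (hθ : Fintype.card V ≤ θ ∨ (∑ v, G.degree v : ℕ) ≤ η * (θ : ℝ) ^ 2) (x : V) :
    1 - η ≤ edgeWeight G θ x := by
  rw [edgeWeight]
  split_ifs with hx
  · linarith
  · have hθ' : ((∑ v, G.degree v : ℕ) : ℝ) ≤ η * (θ : ℝ) ^ 2 := by
      refine hθ.resolve_left fun h => ?_
      have := G.degree_lt_card_verts x
      omega
    have hx' : (θ : ℝ) < G.degree x := by exact_mod_cast not_le.1 hx
    have hd : (0 : ℝ) < G.degree x := lt_of_le_of_lt (by positivity) hx'
    rw [le_div_iff₀ hd]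
    have h1 := Finset.card_filter_add_card_filter_not (s := G.neighborFinset x)
      (fun u => G.degree u ≤ θ)
    rw [SimpleGraph.card_neighborFinset_eq_degree] at h1
    have h2 : ((G.neighborFinset x).filter fun u => ¬ G.degree u ≤ θ).card ≤
        (Finset.univ.filter fun u => ¬ G.degree u ≤ θ).card :=
      Finset.card_le_card (Finset.filter_subset_filter _ (Finset.subset_univ _))
    have h3 := (Nat.mul_le_mul_right θ h2).trans (card_heavy_mul_le G θ)
    have h1' : (((G.neighborFinset x).filter fun u => G.degree u ≤ θ).card : ℝ) +
        ((G.neighborFinset x).filter fun u => ¬ G.degree u ≤ θ).card = G.degree x := by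
      exact_mod_cast h1
    have h3' : (((G.neighborFinset x).filter fun u => ¬ G.degree u ≤ θ).card : ℝ) * θ ≤
        (∑ v, G.degree v : ℕ) := by exact_mod_cast h3
    -- For `θ = 0` the hypothesis says that there are no edges, yet `x` has positive degree.
    rcases Nat.eq_zero_or_pos θ with rfl | hpos
    · have hm : ((∑ v, G.degree v : ℕ) : ℝ) ≤ 0 := by simpa using hθ'
      have : (G.degree x : ℝ) ≤ (∑ v, G.degree v : ℕ) := by
        exact_mod_cast Finset.single_le_sum (f := fun v => G.degree v) (fun _ _ => Nat.zero_le _)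
          (Finset.mem_univ x)
      linarith
    · have hpos' : (0 : ℝ) < θ := by exact_mod_cast hpos
      have h4 : (((G.neighborFinset x).filter fun u => ¬ G.degree u ≤ θ).card : ℝ) ≤ η * θ := by
        refine le_of_mul_le_mul_right ?_ hpos'
        nlinarith
      nlinarith

end TrialLaw

/-! ### Repeated attempts with varying laws -/

section Repetition

/-- The probability that the attempts `t, …, t + g - 1` fail if the attempt `i` fails with
probability `r i`. -/
def survival (r : ℕ → ℝ) : ℕ → ℕ → ℝ
  | 0, _ => 1
  | g + 1, t => r t * survival r g (t + 1)

/-- The sum of `a i` over the attempts `t, …, t + g - 1`, each weighted by the probability that it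
takes place. -/
def weightedSum (r a : ℕ → ℝ) : ℕ → ℕ → ℝ
  | 0, _ => 0
  | g + 1, t => a t + r t * weightedSum r a g (t + 1)

theorem survival_nonneg {r : ℕ → ℝ} (hr : ∀ t, 0 ≤ r t) (g t : ℕ) : 0 ≤ survival r g t := by
  induction g generalizing t with
  | zero => exact zero_le_one
  | succ g ih => exact mul_nonneg (hr t) (ih _)

theorem survival_le_one {r : ℕ → ℝ} (hr : ∀ t, 0 ≤ r t) (hr' : ∀ t, r t ≤ 1) (g t : ℕ) :
    survival r g t ≤ 1 := by
  induction g generalizing t with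
  | zero => exact le_rfl
  | succ g ih => exact mul_le_one₀ (hr' t) (survival_nonneg hr _ _) (ih _)

theorem survival_add (r : ℕ → ℝ) (g h t : ℕ) :
    survival r (g + h) t = survival r g t * survival r h (t + g) := by
  induction g generalizing t with
  | zero => simp [survival]
  | succ g ih =>
    rw [Nat.add_right_comm, survival, ih, survival, mul_assoc, add_assoc, Nat.add_comm 1 g]

theorem survival_le_pow {r : ℕ → ℝ} {p : ℝ} (hr : ∀ t, 0 ≤ r t) {h t : ℕ}
    (hp : ∀ i, t ≤ i → i < t + h → r i ≤ 1 - p) : survival r h t ≤ (1 - p) ^ h := by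
  induction h generalizing t with
  | zero => exact le_rfl
  | succ h ih =>
    have h1 := hp t le_rfl (by omega)
    rw [survival, pow_succ']
    exact mul_le_mul h1 (ih (t := t + 1) fun i hi hi' => hp i (by omega) (by omega)) (survival_nonneg hr _ _)
      ((hr t).trans h1)

variable {E : Type*} (tr : ℕ → PMF (Option E))

/-- The probability that an attempt fails. -/
noncomputable def failProb (t : ℕ) : ℝ := (tr t none).toReal

/-- The probability that repeated attempts result in `e`. -/
noncomputable def resultProb (f t : ℕ) (e : E) : ℝ :=
  ((repeatTrials tr f t).map Prod.fst (some e)).toReal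

/-- The expected number of attempts. -/
noncomputable def expectedTrials (f t : ℕ) : ℝ :=
  (expect (repeatTrials tr f t) fun x => (x.2 : ℝ≥0∞)).toReal

theorem failProb_nonneg (t : ℕ) : 0 ≤ failProb tr t := ENNReal.toReal_nonneg

theorem failProb_le_one (t : ℕ) : failProb tr t ≤ 1 :=
  (ENNReal.toReal_mono ENNReal.one_ne_top (PMF.coe_le_one _ _)).trans_eq ENNReal.toReal_one

theorem resultProb_nonneg (f t : ℕ) (e : E) : 0 ≤ resultProb tr f t e := ENNReal.toReal_nonneg

variable [Fintype E]

theorem sum_some_add_none (p : PMF (Option E)) :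
    ∑ e, (p (some e)).toReal + (p none).toReal = 1 := by
  have h := p.tsum_coe
  rw [tsum_fintype, Fintype.sum_option] at h
  have h' := congrArg ENNReal.toReal h
  rw [ENNReal.toReal_add (p.apply_ne_top _)
    (ENNReal.sum_ne_top.2 fun e _ => p.apply_ne_top _),
    ENNReal.toReal_sum fun e _ => p.apply_ne_top _, ENNReal.toReal_one] at h'
  rw [← h', add_comm]

theorem sum_resultProb_le_one (f t : ℕ) : ∑ e, resultProb tr f t e ≤ 1 := by
  have h := sum_some_add_none ((repeatTrials tr f t).map Prod.fst)
  have h' : 0 ≤ (((repeatTrials tr f t).map Prod.fst) none).toReal := ENNReal.toReal_nonneg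
  simp only [resultProb]
  linarith

omit [Fintype E] in
theorem resultProb_le_one (f t : ℕ) (e : E) : resultProb tr f t e ≤ 1 :=
  (ENNReal.toReal_mono ENNReal.one_ne_top (PMF.coe_le_one _ _)).trans_eq ENNReal.toReal_one

theorem expect_repeatTrials_succ (f t : ℕ) (F : Option E × ℕ → ℝ≥0∞) :
    expect (repeatTrials tr (f + 1) t) F =
      tr t none * expect (repeatTrials tr f (t + 1)) (fun x => F (x.1, x.2 + 1)) +
        ∑ e, tr t (some e) * F (some e, 1) := by
  rw [repeatTrials, expect_bind, expect, tsum_fintype, Fintype.sum_option]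
  simp [expect_map, expect_pure]

omit [Fintype E] in
theorem resultProb_zero (t : ℕ) (e : E) : resultProb tr 0 t e = 0 := by
  classical
  rw [resultProb, ← expect_indicator_singleton, expect_map, repeatTrials, expect_pure]
  simp

theorem resultProb_succ (f t : ℕ) (e : E) :
    resultProb tr (f + 1) t e =
      (tr t (some e)).toReal + failProb tr t * resultProb tr f (t + 1) e := by
  classical
  have h : (repeatTrials tr (f + 1) t).map Prod.fst (some e) =
      tr t none * (repeatTrials tr f (t + 1)).map Prod.fst (some e) + tr t (some e) := by
    rw [← expect_indicator_singleton (PMF.map _ (repeatTrials tr (f + 1) t)), expect_map,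
      expect_repeatTrials_succ, ← expect_indicator_singleton (PMF.map _ _), expect_map]
    simp
  rw [resultProb, h, ENNReal.toReal_add
    (ENNReal.mul_ne_top (PMF.apply_ne_top _ _) (PMF.apply_ne_top _ _)) (PMF.apply_ne_top _ _),
    ENNReal.toReal_mul, add_comm]
  rfl

theorem sum_resultProb_succ (f t : ℕ) :
    ∑ e, resultProb tr (f + 1) t e =
      (1 - failProb tr t) + failProb tr t * ∑ e, resultProb tr f (t + 1) e := by
  simp only [resultProb_succ, Finset.sum_add_distrib, ← Finset.mul_sum]
  have := sum_some_add_none (tr t)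
  rw [failProb]
  linarith

theorem expect_trials_succ (f t : ℕ) :
    (expect (repeatTrials tr (f + 1) t) fun x => (x.2 : ℝ≥0∞)) =
      1 + tr t none * expect (repeatTrials tr f (t + 1)) fun x => (x.2 : ℝ≥0∞) := by
  rw [expect_repeatTrials_succ]
  have h := (tr t).tsum_coe
  rw [tsum_fintype, Fintype.sum_option] at h
  simp only [Nat.cast_add, Nat.cast_one, expect_add, expect_const, mul_one, mul_add]
  rw [add_assoc, h, add_comm]

theorem expect_trials_le (f t : ℕ) :
    (expect (repeatTrials tr f t) fun x => (x.2 : ℝ≥0∞)) ≤ f := by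
  induction f generalizing t with
  | zero => rw [repeatTrials, expect_pure]
  | succ f ih =>
    rw [expect_trials_succ, add_comm]
    push_cast
    gcongr
    exact (mul_le_mul' (PMF.coe_le_one _ _) (ih _)).trans_eq (one_mul _)

theorem expectedTrials_le (f t : ℕ) : expectedTrials tr f t ≤ f :=
  ENNReal.toReal_le_of_le_ofReal (by positivity) (by simpa using expect_trials_le tr f t)

theorem expectedTrials_succ (f t : ℕ) :
    expectedTrials tr (f + 1) t = 1 + failProb tr t * expectedTrials tr f (t + 1) := by
  have hne : (expect (repeatTrials tr f (t + 1)) fun x => (x.2 : ℝ≥0∞)) ≠ ⊤ :=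
    ((expect_trials_le tr f (t + 1)).trans_lt (ENNReal.natCast_lt_top f)).ne
  rw [expectedTrials, expect_trials_succ, ENNReal.toReal_add ENNReal.one_ne_top
    (ENNReal.mul_ne_top (PMF.apply_ne_top _ _) hne), ENNReal.toReal_mul, ENNReal.toReal_one]
  rfl

theorem expectedTrials_add_le (g b t : ℕ) :
    expectedTrials tr (g + b) t ≤ g + survival (failProb tr) g t * b := by
  induction g generalizing t with
  | zero => simpa [survival] using expectedTrials_le tr b t
  | succ g ih =>
    rw [Nat.add_right_comm, expectedTrials_succ, survival]
    have h1 := mul_le_mul_of_nonneg_left (ih (t + 1)) (failProb_nonneg tr t)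
    have h2 : failProb tr t * g ≤ g :=
      mul_le_of_le_one_left (by positivity) (failProb_le_one tr t)
    push_cast
    nlinarith

/-- The first `g` attempts cost at most the mean of a geometric variable, since `1 + (1 - p) / p = 1
/ p`; the rest are paid for only if all of these fail. -/
theorem expectedTrials_add_le_inv {g t : ℕ} (b : ℕ) {p : ℝ} (hp₀ : 0 < p)
    (hp : ∀ i, t ≤ i → i < t + g → failProb tr i ≤ 1 - p) :
    expectedTrials tr (g + b) t ≤ p⁻¹ + survival (failProb tr) g t * b := by
  induction g generalizing t with
  | zero =>
    have := expectedTrials_le tr b t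
    have : 0 < p⁻¹ := inv_pos.2 hp₀
    simp only [survival, zero_add]
    linarith
  | succ g ih =>
    rw [Nat.add_right_comm, expectedTrials_succ, survival]
    have h1 := mul_le_mul_of_nonneg_left
      (ih (t := t + 1) fun i hi hi' => hp i (by omega) (by omega)) (failProb_nonneg tr t)
    have h2 := mul_le_mul_of_nonneg_right (hp t le_rfl (by omega)) (inv_pos.2 hp₀).le
    have h3 : (1 - p) * p⁻¹ = p⁻¹ - 1 := by field_simp
    nlinarith

/-- Nothing is assumed about the last `b` attempts: they are reached only with the survival
probability, which bounds what they can add. The main term does not depend on `e`. -/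
theorem resultProb_add_bounds {a : ℕ → ℝ} {η : ℝ} {g t : ℕ} (b : ℕ) {e : E}
    (hlow : ∀ i, t ≤ i → i < t + g → (1 - η) * a i ≤ (tr i (some e)).toReal)
    (hup : ∀ i, t ≤ i → i < t + g → (tr i (some e)).toReal ≤ a i) :
    (1 - η) * weightedSum (failProb tr) a g t ≤ resultProb tr (g + b) t e ∧
      resultProb tr (g + b) t e ≤
        weightedSum (failProb tr) a g t + survival (failProb tr) g t := by
  induction g generalizing t with
  | zero =>
    simpa [survival, weightedSum] using ⟨resultProb_nonneg tr b t e, resultProb_le_one tr b t e⟩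
  | succ g ih =>
    rw [Nat.add_right_comm, resultProb_succ, weightedSum, survival]
    obtain ⟨h1, h2⟩ := ih (t := t + 1) (fun i hi hi' => hlow i (by omega) (by omega))
      (fun i hi hi' => hup i (by omega) (by omega))
    have h3 := hlow t le_rfl (by omega)
    have h4 := hup t le_rfl (by omega)
    have h5 := mul_le_mul_of_nonneg_left h1 (failProb_nonneg tr t)
    have h6 := mul_le_mul_of_nonneg_left h2 (failProb_nonneg tr t)
    constructor <;> nlinarith

theorem one_sub_survival_le_sum (g b t : ℕ) :
    1 - survival (failProb tr) g t ≤ ∑ e, resultProb tr (g + b) t e := by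
  induction g generalizing t with
  | zero =>
    simpa [survival] using Finset.sum_nonneg fun e _ => resultProb_nonneg tr b t e
  | succ g ih =>
    rw [Nat.add_right_comm, sum_resultProb_succ, survival]
    have := mul_le_mul_of_nonneg_left (ih (t + 1)) (failProb_nonneg tr t)
    nlinarith

theorem sum_resultProb_add_le {a : ℕ → ℝ} {m : ℝ} {g t : ℕ} (b : ℕ)
    (ha : ∀ i, t ≤ i → i < t + g → 1 - failProb tr i ≤ m * a i) :
    ∑ e, resultProb tr (g + b) t e ≤
      m * weightedSum (failProb tr) a g t + survival (failProb tr) g t := by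
  induction g generalizing t with
  | zero => simpa [survival, weightedSum] using sum_resultProb_le_one tr b t
  | succ g ih =>
    rw [Nat.add_right_comm, sum_resultProb_succ, weightedSum, survival]
    have h1 := mul_le_mul_of_nonneg_left
      (ih (t := t + 1) fun i hi hi' => ha i (by omega) (by omega)) (failProb_nonneg tr t)
    have h2 := ha t le_rfl (by omega)
    nlinarith

/-- The left side telescopes into the success probabilities `1 - r i`, each weighted by the chance
that attempt `i` takes place. -/
theorem one_sub_survival_le_weightedSum {r a : ℕ → ℝ} {m : ℝ} {g t : ℕ} (hr : ∀ t, 0 ≤ r t)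
    (ha : ∀ i, t ≤ i → i < t + g → 1 - r i ≤ m * a i) :
    1 - survival r g t ≤ m * weightedSum r a g t := by
  induction g generalizing t with
  | zero => simp [survival, weightedSum]
  | succ g ih =>
    rw [weightedSum, survival]
    have h1 := mul_le_mul_of_nonneg_left
      (ih (t := t + 1) fun i hi hi' => ha i (by omega) (by omega)) (hr t)
    have h2 := ha t le_rfl (by omega)
    nlinarith

theorem resultProb_eq_zero {f t : ℕ} {e : E} (h : ∀ i, t ≤ i → i < t + f → tr i (some e) = 0) :
    resultProb tr f t e = 0 := by
  induction f generalizing t with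
  | zero => exact resultProb_zero tr t e
  | succ f ih =>
    rw [resultProb_succ, h t le_rfl (by omega), ih fun i hi hi' => h i (by omega) (by omega)]
    simp

end Repetition

/-- With `X = mM`, the bound on `δ` puts both `mA` and `T` between `(1 - η)X` and `(1 + η)X`, so
their quotient is within `4η` of `1`. Here `A` is the probability of one edge and `T` that of
success. -/
theorem abs_div_sub_inv_le {A T M δ η ε m : ℝ} (hm : 1 ≤ m) (hη : 0 < η) (hηε : 4 * η ≤ ε)
    (hε : ε < 1) (hδ : 2 * m * δ ≤ η) (hM : 1 - δ ≤ m * M)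
    (hAl : (1 - η) * M ≤ A) (hAu : A ≤ M + δ) (hTl : (1 - η) * (m * M) ≤ T)
    (hTu : T ≤ m * M + δ) : |A / T - 1 / m| ≤ ε * (1 / m) := by
  have hm₀ : 0 < m := by linarith
  have hδ' : δ ≤ 1 / 2 := by nlinarith
  have hmM : 1 / 2 ≤ m * M := by linarith
  have hM₀ : 0 < M := by
    by_contra h
    nlinarith
  have hδM : δ ≤ η * M := by
    refine le_of_mul_le_mul_left ?_ hm₀
    nlinarith
  have hT : 0 < T := by nlinarith
  have e1 : m * δ ≤ η * (m * M) := by nlinarith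
  have e2 : δ ≤ η * (m * M) := by nlinarith [mul_nonneg hη.le hM₀.le]
  have key : A / T - 1 / m = (m * A - T) / (m * T) := by field_simp
  rw [key, abs_le]
  have hmT : 0 < m * T := by positivity
  have hX : 0 < m * M := by linarith
  have hA1 : (1 - η) * (m * M) ≤ m * A := by
    have := mul_le_mul_of_nonneg_left hAl hm₀.le
    linarith
  have hA2 : m * A ≤ m * M + η * (m * M) := by
    have := mul_le_mul_of_nonneg_left hAu hm₀.le
    linarith
  generalize m * M = X at *
  have e3 : η * η ≤ η / 4 := by nlinarith
  have e4 : η * X * η ≤ η * X / 4 := by nlinarith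
  constructor
  · rw [le_div_iff₀ hmT]
    have : -(ε * (1 / m)) * (m * T) = - (ε * T) := by field_simp
    rw [this]
    have : (1 - ε) * T ≤ (1 - 4 * η) * (X + η * X) := by
      have : T ≤ X + η * X := by linarith
      have h0 : 0 ≤ X + η * X := by positivity
      nlinarith
    nlinarith
  · rw [div_le_iff₀ hmT]
    have : ε * (1 / m) * (m * T) = ε * T := by field_simp
    rw [this]
    have : (1 + 4 * η) * ((1 - η) * X) ≤ (1 + ε) * T := by
      have : 0 ≤ (1 - η) * X := mul_nonneg (by linarith) hX.le
      nlinarith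
    nlinarith

/-! ### Choice of parameters and numerical estimates -/

section Parameters

/-- The smallest threshold down to which attempts are almost unbiased. -/
def criticalThreshold (n m N : ℕ) : ℕ := min n (Nat.sqrt (4 * (N * m)) + 1)

/-- Half the number of the last attempt that is almost unbiased. -/
def halfTime (n m N : ℕ) : ℕ := lastTrial n N / (2 * criticalThreshold n m N)

variable {n m N : ℕ}

theorem criticalThreshold_pos (hn : 0 < n) : 0 < criticalThreshold n m N :=
  lt_min hn (Nat.succ_pos _)

theorem sq_criticalThreshold_le (hm : 1 ≤ m) (hN : 1 ≤ N) :
    criticalThreshold n m N ^ 2 ≤ 16 * (N * m) := by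
  have h1 : 1 ≤ N * m := Nat.mul_pos hN hm
  have h2 : 1 ≤ Nat.sqrt (4 * (N * m)) := Nat.sqrt_pos.2 (by omega)
  have h3 := Nat.sqrt_le' (4 * (N * m))
  have h4 : criticalThreshold n m N ≤ 2 * Nat.sqrt (4 * (N * m)) :=
    (min_le_right _ _).trans (by omega)
  nlinarith [Nat.pow_le_pow_left h4 2]

/-- These are the two alternatives of `one_sub_le_edgeWeight` for `η = 1/(4N)`. -/
theorem le_criticalThreshold :
    n ≤ criticalThreshold n m N ∨ 4 * (N * m) ≤ criticalThreshold n m N ^ 2 := by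
  rcases min_choice n (Nat.sqrt (4 * (N * m)) + 1) with h | h
  · exact Or.inl h.ge
  · right
    rw [criticalThreshold, h]
    exact (Nat.lt_succ_sqrt' _).le

theorem firstTrial_pos (hn : 1 < n) (hN : 1 ≤ N) : 0 < firstTrial n N :=
  Nat.mul_pos (by norm_num) (Nat.mul_pos hN (Nat.clog_pos (by norm_num) hn))

theorem firstTrial_le_halfTime (hn : 0 < n) : firstTrial n N ≤ halfTime n m N := by
  rw [halfTime, Nat.le_div_iff_mul_le (by have := criticalThreshold_pos (m := m) (N := N) hn; omega),
    lastTrial]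
  have : criticalThreshold n m N ≤ n := min_le_left _ _
  nlinarith [Nat.zero_le (firstTrial n N), Nat.mul_le_mul_left (firstTrial n N) this]

theorem halfTime_mul_le : criticalThreshold n m N * (2 * halfTime n m N) ≤ lastTrial n N := by
  have := Nat.div_mul_le_self (lastTrial n N) (2 * criticalThreshold n m N)
  rw [halfTime]
  nlinarith

theorem two_halfTime_le (hn : 0 < n) : 2 * halfTime n m N ≤ lastTrial n N :=
  (Nat.le_mul_of_pos_left _ (criticalThreshold_pos hn)).trans halfTime_mul_le

theorem lastTrial_le (hn : 1 < n) (hN : 1 ≤ N) :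
    lastTrial n N ≤ 4 * (halfTime n m N * criticalThreshold n m N) := by
  have h1 : 1 ≤ halfTime n m N :=
    (firstTrial_pos hn hN).trans_le (firstTrial_le_halfTime (by omega))
  have h2 := criticalThreshold_pos (m := m) (N := N) (n := n) (by omega)
  have h3 := Nat.lt_mul_div_succ (lastTrial n N)
    (show 0 < 2 * criticalThreshold n m N by omega)
  rw [← halfTime] at h3
  nlinarith

theorem lastTrial_lt_wordModulus (hn : 1 < n) (hN : 1 < N) :
    lastTrial n N + 1 < wordModulus 10 n N := by
  have h1 : n * N ≤ 2 ^ Nat.clog 2 (n * N) := Nat.le_pow_clog (by norm_num) _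
  have h2 : (n * N) ^ 10 ≤ wordModulus 10 n N := by
    rw [wordModulus, mul_comm 10, pow_mul]
    exact Nat.pow_le_pow_left h1 10
  have hL : Nat.clog 2 n ≤ n := Nat.clog_le_of_le_pow Nat.lt_two_pow_self.le
  have h4 : 4 ≤ n * N := Nat.mul_le_mul hn hN
  have h5 : n * (N * n) ≤ (n * N) ^ 2 := by nlinarith
  have h6 : lastTrial n N ≤ 16384 * (n * N) ^ 2 := by
    rw [lastTrial, firstTrial]
    have := Nat.mul_le_mul_left n (Nat.mul_le_mul_left N hL)
    nlinarith
  -- As `nN ≥ 4`, eight of the ten factors absorb the constant `16384 < 4 ^ 8`.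
  have h7 : 4 ^ 8 * (n * N) ^ 2 ≤ (n * N) ^ 10 := by
    rw [show 10 = 8 + 2 by norm_num, pow_add]
    exact Nat.mul_le_mul_right _ (Nat.pow_le_pow_left h4 8)
  have h8 : 1 ≤ (n * N) ^ 2 := Nat.one_le_pow _ _ (by omega)
  norm_num at h7
  omega

/-- The success probability of the attempts between `halfTime` and `2 * halfTime`. -/
noncomputable def successBound (n m N : ℕ) : ℝ :=
  m * halfTime n m N / (4 * n * lastTrial n N)

theorem clog_le_four_mul_log (hn : 1 < n) : (Nat.clog 2 n : ℝ) ≤ 4 * Real.log n := by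
  have h1 := Nat.pow_pred_clog_lt_self (b := 2) (by norm_num) hn
  have hpos : 0 < Nat.clog 2 n := Nat.clog_pos (by norm_num) hn
  have h2 : ((Nat.clog 2 n).pred : ℝ) * Real.log 2 ≤ Real.log n := by
    rw [← Real.log_pow]
    exact Real.log_le_log (by positivity) (by exact_mod_cast h1.le)
  have h3 : Real.log 2 ≤ Real.log n := Real.log_le_log (by norm_num) (by exact_mod_cast hn)
  have h4 : (Nat.clog 2 n : ℝ) = (Nat.clog 2 n).pred + 1 := by
    exact_mod_cast (Nat.succ_pred_eq_of_pos hpos).symm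
  have h5 := Real.log_two_gt_d9
  have h6 : (0 : ℝ) ≤ (Nat.clog 2 n).pred := by positivity
  nlinarith

/-- The exponent `p h = m h² / (4nK)` is at least `256 L x` with `x = Nm/τ²`, because `h ≥ K/(4τ)`.
Although `N` is not bounded in terms of `n`, `L` alone need not control it: `τ ≤ n` makes `x` grow
with `N`. -/
theorem one_sub_successBound_pow_le (hn : 1 < n) (hm : 1 ≤ m) (hN : 1 ≤ N)
    (hp : successBound n m N ≤ 1) :
    (1 - successBound n m N) ^ halfTime n m N ≤ 1 / (8 * N * m * n) := by
  set h := halfTime n m N with hh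
  set K := lastTrial n N with hK
  set τ := criticalThreshold n m N with hτ
  set L := Nat.clog 2 n with hL
  have hL₁ : (1 : ℝ) ≤ L := by exact_mod_cast Nat.clog_pos (by norm_num) hn
  have hn₁ : (2 : ℝ) ≤ n := by exact_mod_cast hn
  have hm₁ : (1 : ℝ) ≤ m := by exact_mod_cast hm
  have hN₁ : (1 : ℝ) ≤ N := by exact_mod_cast hN
  have hτ₀ : (0 : ℝ) < τ := by exact_mod_cast criticalThreshold_pos (by omega)
  have hτn : (τ : ℝ) ≤ n := by exact_mod_cast min_le_left _ _
  have hτ₂ : (τ : ℝ) ^ 2 ≤ 16 * (N * m) := by exact_mod_cast sq_criticalThreshold_le hm hN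
  have hKe : (K : ℝ) = 2 * (n * (8192 * (N * L))) := by
    rw [hK, lastTrial, firstTrial]
    push_cast
    ring
  have hK₀ : (0 : ℝ) < K := by rw [hKe]; positivity
  have hKh : (K : ℝ) ≤ 4 * (h * τ) := by exact_mod_cast lastTrial_le hn hN
  have h1 : (1 - successBound n m N) ^ h ≤ Real.exp (-(successBound n m N * h)) := by
    calc (1 - successBound n m N) ^ h ≤ Real.exp (-successBound n m N) ^ h :=
          pow_le_pow_left₀ (by linarith) (Real.one_sub_le_exp_neg _) _
      _ = _ := by rw [← Real.exp_nat_mul]; ring_nf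
  set x : ℝ := N * m / τ ^ 2 with hx
  have hx₀ : 1 / 16 ≤ x := by
    rw [hx, le_div_iff₀ (by positivity)]
    linarith
  have h2 : 256 * L * x ≤ successBound n m N * h := by
    have e1 : (K : ℝ) ^ 2 ≤ 16 * (h ^ 2 * τ ^ 2) := by
      calc (K : ℝ) ^ 2 ≤ (4 * (h * τ)) ^ 2 := pow_le_pow_left₀ hK₀.le hKh 2
        _ = _ := by ring
    have e2 : 256 * L * x = m * (K ^ 2 / (16 * τ ^ 2)) / (4 * n * K) := by
      rw [hx, hKe]
      field_simp
      norm_num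
    have e3 : (K : ℝ) ^ 2 / (16 * τ ^ 2) ≤ h ^ 2 := by
      rw [div_le_iff₀ (by positivity)]
      linarith
    rw [e2, successBound, ← hh, ← hK, div_mul_eq_mul_div]
    have : (m : ℝ) * h * h = m * h ^ 2 := by ring
    rw [this]
    gcongr
  have hnL : (n : ℝ) ≤ Real.exp L := by
    have e1 : (n : ℝ) ≤ 2 ^ L := by exact_mod_cast Nat.le_pow_clog (by norm_num) n
    have e2 : (2 : ℝ) ^ L ≤ Real.exp 1 ^ L :=
      pow_le_pow_left₀ (by norm_num) (by linarith [Real.add_one_le_exp 1]) _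
    rw [← Real.exp_nat_mul, mul_one] at e2
    exact e1.trans e2
  have h3 : 8 * N * m * n ≤ Real.exp (successBound n m N * h) := by
    have e1 : (8 : ℝ) * N * m * n ≤ x * n ^ 6 := by
      have e2 : (N : ℝ) * m = x * τ ^ 2 := by rw [hx]; field_simp
      have e3 : (8 : ℝ) ≤ n ^ 3 := by
        calc (8 : ℝ) = 2 ^ 3 := by norm_num
          _ ≤ n ^ 3 := pow_le_pow_left₀ (by norm_num) hn₁ 3
      calc (8 : ℝ) * N * m * n = 8 * (x * τ ^ 2) * n := by rw [← e2]; ring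
        _ ≤ n ^ 3 * (x * n ^ 2) * n := by gcongr
        _ = x * n ^ 6 := by ring
    calc (8 : ℝ) * N * m * n ≤ x * n ^ 6 := e1
      _ ≤ Real.exp x * Real.exp L ^ 6 := by
        gcongr
        linarith [Real.add_one_le_exp x]
      _ = Real.exp (x + 6 * L) := by rw [Real.exp_add, ← Real.exp_nat_mul]; norm_num
      -- Since `x ≥ 1/16` and `L ≥ 1`, one has `x ≤ Lx` and `6L ≤ 96Lx`.
      _ ≤ Real.exp (256 * L * x) := by
        refine Real.exp_le_exp.2 ?_
        nlinarith
      _ ≤ _ := Real.exp_le_exp.2 h2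
  refine h1.trans ?_
  rw [Real.exp_neg, one_div]
  exact inv_anti₀ (by positivity) h3

/-- If `τ < n`, counting the attempts before `2h ≤ K/τ` suffices. If `τ = n`, the unbiased phase
begins at once but its length, of order `NL`, may be far too large; the geometric bound `1/p =
8n²/m` replaces it. -/
theorem trials_le {ε E δ : ℝ} (hn : 1 < n) (hm : 1 ≤ m) (hN : 1 ≤ N) (hε : 0 < ε)
    (hε' : ε < 1) (hNε : N * ε ≤ 2) (hmn : m ≤ n ^ 2) (hδ : δ ≤ 1 / (8 * N * m * n))
    (h₁ : E ≤ (2 * halfTime n m N - firstTrial n N : ℕ) +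
      δ * (lastTrial n N + 1 - 2 * halfTime n m N : ℕ))
    (h₂ : halfTime n m N = firstTrial n N → E ≤ (successBound n m N)⁻¹ +
      δ * (lastTrial n N + 1 - 2 * halfTime n m N : ℕ)) :
    Nat.clog 2 n + 5 * E ≤ 400000 * (n / √(ε * m)) * Real.log n := by
  have hh : 0 < halfTime n m N := (firstTrial_pos hn hN).trans_le (firstTrial_le_halfTime (by omega))
  have hclog := clog_le_four_mul_log hn
  set L := Nat.clog 2 n with hL
  have hL₁ : (1 : ℝ) ≤ L := by exact_mod_cast Nat.clog_pos (by norm_num) hn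
  have hn₁ : (2 : ℝ) ≤ n := by exact_mod_cast hn
  have hm₁ : (1 : ℝ) ≤ m := by exact_mod_cast hm
  have hN₁ : (1 : ℝ) ≤ N := by exact_mod_cast hN
  have hmn' : (m : ℝ) ≤ n ^ 2 := by exact_mod_cast hmn
  have hKe : (lastTrial n N : ℝ) = 2 * (n * (8192 * (N * L))) := by
    rw [lastTrial, firstTrial]
    push_cast
    ring
  set Q : ℝ := n / √(ε * m) with hQ
  have hQ₀ : 0 ≤ Q := by positivity
  have hQ₂ : Q ^ 2 = n ^ 2 / (ε * m) := by rw [hQ, div_pow, Real.sq_sqrt (by positivity)]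
  have hQ₁ : 1 ≤ Q := by
    refine le_of_abs_le (abs_le_of_sq_le_sq ?_ hQ₀)
    rw [hQ₂, one_pow, le_div_iff₀ (by positivity)]
    nlinarith
  -- At most `K = 16384 n N L` attempts remain, and they are reached with probability at most
  -- `1/(8Nmn)`.
  have hrest : δ * (lastTrial n N + 1 - 2 * halfTime n m N : ℕ) ≤ 2048 * L := by
    have e1 : ((lastTrial n N + 1 - 2 * halfTime n m N : ℕ) : ℝ) ≤ lastTrial n N := by
      exact_mod_cast (by omega)
    calc δ * (lastTrial n N + 1 - 2 * halfTime n m N : ℕ)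
        ≤ 1 / (8 * N * m * n) * lastTrial n N := by gcongr
      _ = 2048 * L / m := by
        rw [hKe]
        field_simp
        norm_num
      _ ≤ 2048 * L := div_le_self (by positivity) hm₁
  have hsq : (n : ℝ) ^ 2 * N / m ≤ 2 * Q ^ 2 := by
    rw [hQ₂]
    have : 2 * ((n : ℝ) ^ 2 / (ε * m)) = n ^ 2 * (2 / ε) / m := by field_simp
    rw [this]
    gcongr
    rwa [le_div_iff₀ hε]
  have hLQ : (L : ℝ) ≤ L * Q := le_mul_of_one_le_right (by positivity) hQ₁
  suffices hE : E ≤ 16384 * (L * Q) + 2048 * L by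
    have : (L : ℝ) * Q ≤ 4 * Real.log n * Q := mul_le_mul_of_nonneg_right hclog hQ₀
    nlinarith
  by_cases hcase : n ≤ Nat.sqrt (4 * (N * m)) + 1
  · have hτ : criticalThreshold n m N = n := min_eq_left hcase
    have ht : halfTime n m N = firstTrial n N := by
      rw [halfTime, hτ, lastTrial, ← mul_assoc]
      exact Nat.mul_div_cancel_left _ (by omega)
    have hτ₂ := sq_criticalThreshold_le (n := n) hm hN
    rw [hτ] at hτ₂
    have hτ₂' : (n : ℝ) ^ 2 ≤ 16 * (N * m) := by exact_mod_cast hτ₂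
    have hinv : (successBound n m N)⁻¹ = 8 * (n ^ 2 / m) := by
      have e1 : (lastTrial n N : ℝ) = 2 * (n * halfTime n m N) := by
        rw [ht, lastTrial]
        push_cast
        ring
      have e2 : (0 : ℝ) < halfTime n m N := by exact_mod_cast hh
      rw [successBound, e1]
      field_simp
      norm_num
    -- In this case `n² ≤ 16Nm`, so the square of the left side is at most `16 n² N / m ≤ 32 Q²`.
    have hbound : (n : ℝ) ^ 2 / m ≤ 6 * Q := by
      refine le_of_abs_le (abs_le_of_sq_le_sq ?_ (by positivity))
      have : ((n : ℝ) ^ 2 / m) ^ 2 ≤ 16 * (n ^ 2 * N / m) := by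
        rw [div_pow, div_le_iff₀ (by positivity)]
        have : 16 * ((n : ℝ) ^ 2 * N / m) * m ^ 2 = n ^ 2 * (16 * (N * m)) := by field_simp
        rw [this, pow_two ((n : ℝ) ^ 2)]
        gcongr
      nlinarith
    have := h₂ ht
    rw [hinv] at this
    nlinarith
  · have hτ : Nat.sqrt (4 * (N * m)) + 1 = criticalThreshold n m N :=
      (min_eq_right (by omega)).symm
    have hτ₂ : 4 * ((N : ℝ) * m) ≤ criticalThreshold n m N ^ 2 := by
      rw [← hτ]
      exact_mod_cast (Nat.lt_succ_sqrt' _).le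
    have hτ₀ : (0 : ℝ) < criticalThreshold n m N := by
      exact_mod_cast criticalThreshold_pos (by omega)
    have h3 : ((2 * halfTime n m N : ℕ) : ℝ) ≤ lastTrial n N / criticalThreshold n m N := by
      rw [le_div_iff₀ hτ₀, mul_comm]
      exact_mod_cast halfTime_mul_le
    have h4 : (lastTrial n N : ℝ) / criticalThreshold n m N ≤ 16384 * (L * Q) := by
      refine le_of_abs_le (abs_le_of_sq_le_sq ?_ (by positivity))
      calc ((lastTrial n N : ℝ) / criticalThreshold n m N) ^ 2
          = lastTrial n N ^ 2 / criticalThreshold n m N ^ 2 := div_pow _ _ _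
        _ ≤ lastTrial n N ^ 2 / (4 * (N * m)) := by gcongr
        _ = (8192 * L) ^ 2 * (n ^ 2 * N / m) := by
          rw [hKe]
          field_simp
          norm_num
        _ ≤ (8192 * L) ^ 2 * (2 * Q ^ 2) := by gcongr
        _ ≤ (16384 * (L * Q)) ^ 2 := by nlinarith [sq_nonneg (L * Q)]
    have h5 : ((2 * halfTime n m N - firstTrial n N : ℕ) : ℝ) ≤ (2 * halfTime n m N : ℕ) := by
      exact_mod_cast Nat.sub_le _ _
    linarith

end Parameters

/-! ### Correctness and cost of the abstract process -/

section Analysis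

variable {V : Type*} [Fintype V] [Nonempty V] (G : SimpleGraph V) [DecidableRel G.Adj]
  (nbr : (v : V) → Fin (G.degree v) ≃ G.neighborSet v)

omit [Nonempty V] in
theorem sum_adj_const (b : ℝ) :
    (∑ e : V × V, if G.Adj e.1 e.2 then b else 0) = (∑ v, G.degree v : ℕ) * b := by
  rw [Fintype.sum_prod_type, Nat.cast_sum, Finset.sum_mul]
  refine Finset.sum_congr rfl fun x _ => ?_
  rw [← Finset.sum_filter, Finset.sum_const, nsmul_eq_mul, ← SimpleGraph.neighborFinset_eq_filter,
    SimpleGraph.card_neighborFinset_eq_degree]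

theorem one_sub_failProb_trial {θ : ℕ} (hθ : 0 < θ) :
    1 - (trial G nbr θ none).toReal =
      ∑ e : V × V, if G.Adj e.1 e.2 then edgeWeight G θ e.1 / (2 * Fintype.card V * θ) else 0 := by
  classical
  have := sum_some_add_none (trial G nbr θ)
  rw [← this, add_sub_cancel_right]
  exact Finset.sum_congr rfl fun e _ => by rw [← trial_apply G nbr hθ e.1 e.2]

theorem sampler_analysis {n m N : ℕ} {ε : ℝ} (hV : n = Fintype.card V)
    (hm : m = ∑ v, G.degree v) (hm₁ : 1 ≤ m) (hn : 1 < n) (hN : 1 < N) (hε : 0 < ε) (hε' : ε < 1)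
    (hNε : 1 ≤ N * ε) (hNε' : N * ε ≤ 2) (tr : ℕ → PMF (Option (V × V)))
    (htr : tr = fun i => trial G nbr (lastTrial n N / i)) {f t : ℕ}
    (hf : f = lastTrial n N + 1 - firstTrial n N) (ht : t = firstTrial n N) :
    (∀ x y, ¬ G.Adj x y → resultProb tr f t (x, y) = 0) ∧
      2 / 3 ≤ ∑ e, resultProb tr f t e ∧
      (∀ x y, G.Adj x y → |resultProb tr f t (x, y) / (∑ e, resultProb tr f t e) - 1 / m| ≤
        ε * (1 / m)) ∧
      Nat.clog 2 n + 5 * expectedTrials tr f t ≤ 400000 * (n / √(ε * m)) * Real.log n := by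
  classical
  set K := lastTrial n N with hK
  set τ := criticalThreshold n m N with hτ
  set h := halfTime n m N with hh
  have hN₀ : (0 : ℝ) < N := by exact_mod_cast (by omega)
  have hn₀ : (0 : ℝ) < n := by exact_mod_cast (by omega)
  have hm₀ : (1 : ℝ) ≤ m := by exact_mod_cast hm₁
  have ht₀ : 0 < t := ht ▸ firstTrial_pos hn hN.le
  have hth : t ≤ h := ht ▸ firstTrial_le_halfTime (by omega)
  have hhK : 2 * h ≤ K := two_halfTime_le (by omega)
  have hK₀ : (0 : ℝ) < K := by exact_mod_cast (by omega)
  -- Attempts `t, …, 2h - 1` form the almost unbiased phase; the other `b` attempts are controlled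
  -- only through the probability of reaching them.
  set g := 2 * h - t with hg
  set b := K + 1 - 2 * h with hb
  have hfgb : f = g + b := by omega
  set η : ℝ := 1 / (4 * N) with hη
  have hη₀ : 0 < η := by positivity
  have hη₁ : η ≤ 1 / 8 := by
    have : (2 : ℝ) ≤ N := by exact_mod_cast hN
    rw [hη, div_le_div_iff₀ (by positivity) (by norm_num)]
    linarith
  have hηε : 4 * η ≤ ε := by
    rw [hη, mul_one_div, div_le_iff₀ (by positivity)]
    linarith
  set a : ℕ → ℝ := fun i => 1 / (2 * Fintype.card V * (K / i : ℕ)) with ha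
  have hθ : ∀ i, t ≤ i → i ≤ K → 0 < K / i := fun i hi hi' => Nat.div_pos hi' (by omega)
  have hapos : ∀ i, 0 ≤ a i := fun i => by positivity
  have hweight : ∀ i, t ≤ i → i < t + g → ∀ x, 1 - η ≤ edgeWeight G (K / i) x := by
    intro i hi hi' x
    have hτi : τ ≤ K / i := by
      rw [Nat.le_div_iff_mul_le (by omega)]
      exact (Nat.mul_le_mul_left τ (by omega)).trans (halfTime_mul_le (n := n) (m := m) (N := N))
    refine one_sub_le_edgeWeight G hη₀.le ?_ x
    rcases le_criticalThreshold (n := n) (m := m) (N := N) with h1 | h1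
    · exact Or.inl (hV ▸ h1.trans hτi)
    · right
      have h2 : (4 * (N * m) : ℝ) ≤ (K / i : ℕ) ^ 2 := by
        exact_mod_cast h1.trans (Nat.pow_le_pow_left hτi 2)
      rw [← hm, hη, one_div_mul_eq_div, le_div_iff₀ (by positivity)]
      linarith
  have hlow : ∀ x y, G.Adj x y → ∀ i, t ≤ i → i < t + g →
      (1 - η) * a i ≤ (tr i (some (x, y))).toReal := by
    intro x y hxy i hi hi'
    rw [htr, trial_apply G nbr (hθ i hi (by omega)), if_pos hxy, div_eq_mul_one_div]
    exact mul_le_mul_of_nonneg_right (hweight i hi hi' x) (hapos i)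
  have hup : ∀ x y, G.Adj x y → ∀ i, t ≤ i → i < t + g →
      (tr i (some (x, y))).toReal ≤ a i := by
    intro x y hxy i hi hi'
    rw [htr, trial_apply G nbr (hθ i hi (by omega)), if_pos hxy, div_eq_mul_one_div]
    exact mul_le_of_le_one_left (hapos i) (edgeWeight_le_one G _ x)
  have hfail : ∀ i, t ≤ i → i < t + g → 1 - failProb tr i =
      ∑ e : V × V, if G.Adj e.1 e.2 then edgeWeight G (K / i) e.1 / (2 * Fintype.card V *
        (K / i : ℕ)) else 0 := by
    intro i hi hi'
    rw [failProb, htr, one_sub_failProb_trial G nbr (hθ i hi (by omega))]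
  have hsucc : ∀ i, t ≤ i → i < t + g → 1 - failProb tr i ≤ m * a i := by
    intro i hi hi'
    rw [hfail i hi hi', hm, ← sum_adj_const G]
    refine Finset.sum_le_sum fun e _ => ?_
    split_ifs
    · rw [div_eq_mul_one_div]
      exact mul_le_of_le_one_left (hapos i) (edgeWeight_le_one G _ _)
    · rfl
  have hsucc' : ∀ i, t ≤ i → i < t + g → m * ((1 - η) * a i) ≤ 1 - failProb tr i := by
    intro i hi hi'
    rw [hfail i hi hi', hm, ← sum_adj_const G]
    refine Finset.sum_le_sum fun e _ => ?_
    split_ifs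
    · rw [div_eq_mul_one_div (edgeWeight G _ _)]
      exact mul_le_mul_of_nonneg_right (hweight i hi hi' _) (hapos i)
    · rfl
  have hp : ∀ i, h ≤ i → i < 2 * h → failProb tr i ≤ 1 - successBound n m N := by
    intro i hi hi'
    have h1 := hsucc' i (by omega) (by omega)
    have h2 : successBound n m N ≤ m * ((1 - η) * a i) := by
      have e1 : (0 : ℝ) < (K / i : ℕ) := by exact_mod_cast hθ i (by omega) (by omega)
      have e2 : ((K / i : ℕ) : ℝ) * h ≤ K := by
        exact_mod_cast (Nat.mul_le_mul_left _ hi).trans (Nat.div_mul_le_self K i)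
      -- From attempt `h` on the threshold is at most `K/h`. The factor `4` in place of `2` leaves
      -- room for `1 - η ≥ 1/2`.
      have e3 : successBound n m N ≤ m * (1 / (4 * n * (K / i : ℕ))) := by
        rw [successBound, mul_one_div, div_le_div_iff₀ (by positivity) (by positivity)]
        calc (m : ℝ) * h * (4 * n * (K / i : ℕ)) = m * (4 * n) * ((K / i : ℕ) * h) := by ring
          _ ≤ m * (4 * n) * K := by gcongr
          _ = _ := by ring
      refine e3.trans (mul_le_mul_of_nonneg_left ?_ (by linarith))
      have e4 : 1 / (4 * n * ((K / i : ℕ) : ℝ)) = 1 / 2 * a i := by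
        simp only [ha]
        rw [← hV]
        field_simp
        norm_num
      rw [e4]
      exact mul_le_mul_of_nonneg_right (by linarith) (hapos i)
    linarith
  have hpos_h : 0 < h := by omega
  have hp₁ : successBound n m N ≤ 1 := by
    linarith [hp h le_rfl (by omega), failProb_nonneg tr h]
  have hp₀ : 0 < successBound n m N := by
    have : (0 : ℝ) < h := by exact_mod_cast hpos_h
    rw [successBound]
    positivity
  set δ := survival (failProb tr) g t with hδ
  have hδ₁ : δ ≤ 1 / (8 * N * m * n) := by
    -- The attempts before `h` are dropped; the `h` attempts from `h` to `2h - 1` share the bound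
    -- `successBound`.
    have e1 : g = (h - t) + h := by omega
    rw [hδ, e1, survival_add]
    refine (mul_le_of_le_one_left (survival_nonneg (failProb_nonneg tr) _ _)
      (survival_le_one (failProb_nonneg tr) (failProb_le_one tr) _ _)).trans ?_
    refine (survival_le_pow (failProb_nonneg tr) fun i hi hi' => hp i ?_ ?_).trans
      (one_sub_successBound_pow_le hn hm₁ hN.le hp₁)
    · omega
    · omega
  have hδ₂ : 2 * m * δ ≤ η := by
    calc 2 * m * δ ≤ 2 * m * (1 / (8 * N * m * n)) := by gcongr
      _ = η * (1 / n) := by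
        rw [hη]
        field_simp
        norm_num
      _ ≤ η * 1 := by
        gcongr
        rw [div_le_one hn₀]
        exact_mod_cast hn.le
      _ = η := mul_one η
  have hδ₃ : δ ≤ 1 / 3 := by nlinarith [survival_nonneg (failProb_nonneg tr) g t]
  have hzero : ∀ x y, ¬ G.Adj x y → resultProb tr f t (x, y) = 0 := by
    intro x y hxy
    refine resultProb_eq_zero tr fun i hi hi' => ?_
    have := trial_apply G nbr (hθ i hi (by omega)) x y
    rw [if_neg hxy, ENNReal.toReal_eq_zero_iff] at this
    rw [htr]
    exact this.resolve_right (PMF.apply_ne_top _ _)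
  have hM : 1 - δ ≤ m * weightedSum (failProb tr) a g t :=
    one_sub_survival_le_weightedSum (failProb_nonneg tr) hsucc
  have hbounds : ∀ x y, G.Adj x y →
      (1 - η) * weightedSum (failProb tr) a g t ≤ resultProb tr f t (x, y) ∧
      resultProb tr f t (x, y) ≤ weightedSum (failProb tr) a g t + δ := by
    intro x y hxy
    rw [hfgb]
    exact resultProb_add_bounds tr b (hlow x y hxy) (hup x y hxy)
  have hTl : (1 - η) * (m * weightedSum (failProb tr) a g t) ≤ ∑ e, resultProb tr f t e := by
    calc (1 - η) * (m * weightedSum (failProb tr) a g t)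
        = m * ((1 - η) * weightedSum (failProb tr) a g t) := by ring
      _ = ∑ e : V × V, if G.Adj e.1 e.2 then (1 - η) * weightedSum (failProb tr) a g t else 0 := by
          rw [sum_adj_const, hm]
      _ ≤ _ := by
        refine Finset.sum_le_sum fun e _ => ?_
        split_ifs with he
        · exact (hbounds _ _ he).1
        · exact resultProb_nonneg tr f t e
  have hTu : ∑ e, resultProb tr f t e ≤ m * weightedSum (failProb tr) a g t + δ := by
    rw [hfgb]
    exact sum_resultProb_add_le tr b hsucc
  refine ⟨hzero, ?_, ?_, ?_⟩
  · have := one_sub_survival_le_sum tr g b t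
    rw [← hfgb] at this
    linarith
  · intro x y hxy
    obtain ⟨h1, h2⟩ := hbounds x y hxy
    exact abs_div_sub_inv_le hm₀ hη₀ hηε hε' hδ₂ hM h1 h2 hTl hTu
  · have hmn : m ≤ n ^ 2 := by
      rw [hm, hV, pow_two, ← smul_eq_mul, ← Finset.card_univ, ← Finset.sum_const]
      exact Finset.sum_le_sum fun v _ => (G.degree_lt_card_verts v).le
    refine trials_le (δ := δ) hn hm₁ hN.le hε hε' hNε' hmn hδ₁ ?_ ?_
    · rw [hfgb, ← ht]
      exact expectedTrials_add_le tr g b t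
    · intro hht
      rw [hfgb]
      refine expectedTrials_add_le_inv tr b hp₀ fun i hi hi' => hp i ?_ (by omega)
      rw [hh, hht, ← ht]
      exact hi

end Analysis

/-! ### From simulations to output law, queries and time -/

section Termination

variable {V : Type*} [Fintype V] [Nonempty V] (G : SimpleGraph V) [DecidableRel G.Adj]
  (nbr : (v : V) → Fin (G.degree v) ≃ G.neighborSet v) (W : ℕ)

theorem queries_le_of_mem_support_step {c c' : Config V} (h : c' ∈ (step G nbr W c).support) :
    c.queries ≤ c'.queries := by
  rw [step] at h
  split at h
  · rw [PMF.mem_support_pure_iff] at h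
    rw [h]
  · next s rest _ =>
    cases s <;> simp only [exec, PMF.mem_support_pure_iff, PMF.mem_support_map_iff] at h <;>
      first
      | (rw [h]; done)
      | (rw [h]; exact Nat.le_succ _)
      | (obtain ⟨r, -, rfl⟩ := h; first | exact le_rfl | exact Nat.le_succ _)

theorem mem_support_lawFrom_of_halted {c c' : Config V} {s t : ℕ} (hst : s ≤ t)
    (h : c' ∈ (lawFrom G nbr W c s).support) (hc' : c'.Halted) :
    c' ∈ (lawFrom G nbr W c t).support := by
  induction t, hst using Nat.le_induction with
  | base => exact h
  | succ t _ ih =>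
    rw [lawFrom, PMF.mem_support_bind_iff]
    exact ⟨c', ih, by rw [step_halted G nbr W hc']; exact (PMF.mem_support_pure_iff _ _).2 rfl⟩

theorem expect_lawFrom_mono (c : Config V) {F : Config V → ℝ≥0∞}
    (hF : ∀ c c', c' ∈ (step G nbr W c).support → F c ≤ F c') :
    Monotone fun t => expect (lawFrom G nbr W c t) F := by
  refine monotone_nat_of_le_succ fun t => ?_
  rw [lawFrom, expect_bind]
  refine expect_mono fun a _ => ?_
  rw [← expect_const (step G nbr W a) (F a)]
  exact expect_mono fun c' h => hF a c' h

theorem iSup_eq_of_monotone_of_eventually_const {f : ℕ → ℝ≥0∞} (hf : Monotone f) {k : ℕ}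
    {x : ℝ≥0∞} (h : ∀ t, k ≤ t → f t = x) : ⨆ t, f t = x :=
  le_antisymm (iSup_le fun t => (hf (le_max_left t k)).trans_eq (h _ (le_max_right t k)))
    ((h k le_rfl).symm.le.trans (le_iSup f k))

variable {G nbr W} {Ω : Type*} {prog : Cmd} {input : List ℕ} {k : ℕ} {p : PMF Ω}
  {R : Ω → Config V → Prop}

/-- Halted configurations are fixed, so the probabilities increase with `t`, and by the coupling
they are constant from `k` on; the supremum is that constant. -/
theorem Simulates.outputProb_eq {res : Ω → Option (V × V)}
    (h : Simulates G nbr W R k (init W prog input) p) (hR : ∀ ω c, R ω c → c.Halted)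
    (hres : ∀ ω c, R ω c → c.result = res ω) (S : Set (Option (V × V))) :
    outputProb G nbr W prog input S = (p.map res).toOuterMeasure S := by
  classical
  obtain ⟨μ, h1, h2, h3⟩ := h.exists_coupling hR
  rw [outputProb]
  refine iSup_eq_of_monotone_of_eventually_const (k := k) ?_ fun t ht => ?_
  · simp only [toOuterMeasure_eq_expect, law_eq_lawFrom]
    refine expect_lawFrom_mono G nbr W _ fun c c' hc => ?_
    by_cases hc' : c ∈ {c : Config V | c.Halted ∧ c.result ∈ S}
    · rw [step_halted G nbr W hc'.1, PMF.mem_support_pure_iff] at hc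
      rw [hc]
    · rw [if_neg hc']
      exact zero_le
  · rw [law_eq_lawFrom, h3 t ht, toOuterMeasure_eq_expect, toOuterMeasure_eq_expect, ← h1,
      expect_map, expect_map, expect_map]
    refine expect_congr fun x hx => ?_
    have hx := h2 x hx
    simp only [Set.mem_ofPred_eq, hR _ _ hx, hres _ _ hx, true_and]

theorem Simulates.expectedQueries_le {F : Ω → ℝ≥0∞}
    (h : Simulates G nbr W R k (init W prog input) p) (hR : ∀ ω c, R ω c → c.Halted)
    (hF : ∀ ω c, R ω c → (c.queries : ℝ≥0∞) ≤ F ω) :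
    expectedQueries G nbr W prog input ≤ expect p F := by
  obtain ⟨μ, h1, h2, h3⟩ := h.exists_coupling hR
  rw [expectedQueries]
  have hmono : Monotone fun t => expect (law G nbr W prog input t)
      fun c => (c.queries : ℝ≥0∞) := by
    simp only [law_eq_lawFrom]
    refine expect_lawFrom_mono G nbr W _ fun c c' hc => ?_
    exact_mod_cast queries_le_of_mem_support_step G nbr W hc
  refine iSup_le fun t => (hmono (le_max_left t k)).trans ?_
  dsimp only
  rw [law_eq_lawFrom, h3 _ (le_max_right t k), ← h1, expect_map, expect_map]
  exact expect_mono fun x hx => hF _ _ (h2 x hx)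

/-- A configuration halted at any time persists to a time beyond `k`, where the coupling relates it
to some outcome. -/
theorem Simulates.linearTime {C : ℕ} (h : Simulates G nbr W R k (init W prog input) p)
    (hR : ∀ ω c, R ω c → c.Halted) (hC : ∀ ω c, R ω c → c.time ≤ C * c.queries) :
    LinearTime G nbr C W prog input := by
  obtain ⟨μ, h1, h2, h3⟩ := h.exists_coupling hR
  intro t c hc hhalt
  rw [law_eq_lawFrom] at hc
  have := mem_support_lawFrom_of_halted G nbr W (le_max_left t k) hc hhalt
  rw [h3 _ (le_max_right t k), PMF.mem_support_map_iff] at this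
  obtain ⟨x, hx, rfl⟩ := this
  exact hC _ _ (h2 x hx)

end Termination

/-! ### The conditional law of the returned edge -/

section EdgeLaw

variable {V : Type*} [Fintype V] (G : SimpleGraph V) (D : PMF (Option (V × V)))

theorem toOuterMeasure_edges_eq_sum (h : ∀ u v, ¬ G.Adj u v → D (some (u, v)) = 0) :
    D.toOuterMeasure {o | ∃ u v, o = some (u, v) ∧ G.Adj u v} = ∑ e, D (some e) := by
  classical
  rw [toOuterMeasure_eq_expect, expect, tsum_fintype, Fintype.sum_option]
  simp only [Set.mem_ofPred_eq, reduceCtorEq, false_and, exists_false, if_false, mul_zero, zero_add]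
  refine Finset.sum_congr rfl fun ⟨u, v⟩ _ => ?_
  by_cases huv : G.Adj u v
  · simp [huv]
  · simp [h u v huv]

variable [DecidableRel G.Adj] [Nonempty G.Dart]

/-- `P` is `D` conditioned on returning a pair. No mass lies off the edges, so summing over darts
and over all pairs gives the same normalization. -/
theorem exists_pointwiseClose_edgeLaw {ε : ℝ}
    (h : ∀ u v, ¬ G.Adj u v → D (some (u, v)) = 0) (hpos : ∑ e, D (some e) ≠ 0)
    (hclose : ∀ u v, G.Adj u v →
      |(D (some (u, v))).toReal / (∑ e, (D (some e)).toReal) - 1 / (∑ v, G.degree v : ℕ)| ≤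
        ε * (1 / (∑ v, G.degree v : ℕ))) :
    ∃ P : PMF G.Dart, PointwiseClose ε P (PMF.uniformOfFintype G.Dart) ∧
      ∀ e : G.Dart, D.toOuterMeasure {some e.toProd} =
        D.toOuterMeasure {o | ∃ u v, o = some (u, v) ∧ G.Adj u v} * P e := by
  classical
  have htop : ∑ e, D (some e) ≠ ⊤ := ENNReal.sum_ne_top.2 fun e _ => D.apply_ne_top _
  have hsum : ∑ d : G.Dart, D (some d.toProd) = ∑ e, D (some e) := by
    refine Fintype.sum_of_injective (fun d : G.Dart => d.toProd)
      SimpleGraph.Dart.toProd_injective _ _ ?_ fun _ => rfl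
    rintro ⟨u, v⟩ huv
    exact h u v fun hadj => huv ⟨⟨(u, v), hadj⟩, rfl⟩
  refine ⟨PMF.ofFintype (fun d => D (some d.toProd) / ∑ e, D (some e)) ?_, ?_, ?_⟩
  · simp only [div_eq_mul_inv]
    rw [← Finset.sum_mul, hsum, ENNReal.mul_inv_cancel hpos htop]
  · rintro ⟨⟨u, v⟩, huv⟩
    have hcard := G.dart_card_eq_sum_degrees
    have := hclose u v huv
    rw [← hcard] at this
    rw [PMF.ofFintype_apply, PMF.uniformOfFintype_apply, ENNReal.toReal_div,
      ENNReal.toReal_sum fun e _ => D.apply_ne_top _, ENNReal.toReal_inv, ENNReal.toReal_natCast,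
      ← one_div]
    exact this
  · intro e
    rw [toOuterMeasure_edges_eq_sum G D h, PMF.ofFintype_apply, ENNReal.mul_div_cancel hpos htop,
      toOuterMeasure_eq_expect]
    simp only [Set.mem_singleton_iff]
    exact expect_indicator_singleton _ _

end EdgeLaw

end EdgeSampling

/-! ### The main theorem -/

open EdgeSampling in
theorem theorem1 :
    ∃ (prog : Cmd) (κ k C : ℕ),
      ∀ (V : Type*) [Fintype V] [Nonempty V] (G : SimpleGraph V) [DecidableRel G.Adj]
        [Nonempty G.Dart] (nbr : (v : V) → Fin (G.degree v) ≃ G.neighborSet v)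
        (ε : ℝ), 0 < ε → ε < 1 →
        ∀ n m N W : ℕ, n = Fintype.card V → m = ∑ v, G.degree v → N = ⌈1 / ε⌉₊ →
          W = wordModulus κ n N →
          -- expected number of queries
          expectedQueries G nbr W prog [n, N] ≤
              ENNReal.ofReal (C * (n / √(ε * m)) * Real.log n ^ k) ∧
          -- the run halts almost surely, and its running time is linear in its number of queries
          outputProb G nbr W prog [n, N] Set.univ = 1 ∧
          LinearTime G nbr C W prog [n, N] ∧
          -- a returned pair is an edge, and an edge is returned with probability at least 2/3
          outputProb G nbr W prog [n, N] {o | ∃ u v, o = some (u, v) ∧ ¬ G.Adj u v} = 0 ∧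
          2 / 3 ≤ outputProb G nbr W prog [n, N] {o | ∃ u v, o = some (u, v) ∧ G.Adj u v} ∧
          -- the returned edge has a law pointwise close to uniform
          ∃ P : PMF G.Dart,
            PointwiseClose ε P (PMF.uniformOfFintype G.Dart) ∧
            ∀ e : G.Dart,
              outputProb G nbr W prog [n, N] {some e.toProd} =
                outputProb G nbr W prog [n, N] {o | ∃ u v, o = some (u, v) ∧ G.Adj u v} * P e := by
  refine ⟨sampler, 10, 1, 400000, ?_⟩
  intro V _ _ G _ _ nbr ε hε hε' n m N W hn hm hN hW
  obtain ⟨d₀⟩ := ‹Nonempty G.Dart›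
  have hn₁ : 1 < n := by
    rw [hn]
    exact Fintype.one_lt_card_iff.2 ⟨d₀.fst, d₀.snd, d₀.adj.ne⟩
  have hm₁ : 1 ≤ m := by
    rw [hm, ← G.dart_card_eq_sum_degrees]
    exact Fintype.card_pos_iff.2 ⟨d₀⟩
  have hNl : 1 / ε ≤ N := hN ▸ Nat.le_ceil _
  have hNu : (N : ℝ) < 1 / ε + 1 := hN ▸ Nat.ceil_lt_add_one (by positivity)
  have hNε : 1 ≤ N * ε := (div_le_iff₀ hε).1 hNl
  -- Rounding up costs less than `1`, so `Nε < 1 + ε`; thus `N` may replace `1/ε` up to a factor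
  -- `2`.
  have hNε' : N * ε ≤ 2 := by
    have := mul_lt_mul_of_pos_right hNu hε
    rw [add_mul, one_div_mul_cancel hε.ne'] at this
    linarith
  have hN₁ : 1 < N := by
    have : (1 : ℝ) < N := ((one_lt_div hε).2 hε').trans_le hNl
    exact_mod_cast this
  have hKW : lastTrial n N + 1 < W := hW ▸ lastTrial_lt_wordModulus hn₁ hN₁
  have hnK : n ≤ lastTrial n N := by
    have := firstTrial_pos hn₁ hN₁.le
    rw [lastTrial]
    nlinarith
  have hd : ∀ v, G.degree v < W := fun v => by
    have := G.degree_lt_card_verts v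
    omega
  obtain ⟨k, hsim⟩ := simulates_sampler (nbr := nbr) hd hn₁ hN₁.le hKW
  set tr : ℕ → PMF (Option (V × V)) := fun i => trial G nbr (lastTrial n N / i) with htr
  set f := lastTrial n N + 1 - firstTrial n N with hf
  obtain ⟨hzero, hsucc, hclose, hcost⟩ :=
    sampler_analysis G nbr hn hm hm₁ hn₁ hN₁ hε hε' hNε hNε' tr htr hf rfl
  have hR : ∀ ω (c : Config V), SamplerDone n ω c → c.Halted := fun ω c h => h.1
  have hout := hsim.outputProb_eq hR (res := Prod.fst) fun ω c h => h.2.1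
  set D := (repeatTrials tr f (firstTrial n N)).map Prod.fst with hD
  have hDzero : ∀ u v, ¬ G.Adj u v → D (some (u, v)) = 0 := fun u v huv =>
    (ENNReal.toReal_eq_zero_iff _).1 (hzero u v huv) |>.resolve_right (D.apply_ne_top _)
  have hsum : 2 / 3 ≤ ∑ e, D (some e) := by
    have h1 : ∑ e, resultProb tr f (firstTrial n N) e = (∑ e, D (some e)).toReal :=
      (ENNReal.toReal_sum fun e _ => D.apply_ne_top _).symm
    rw [h1] at hsucc
    have h2 := ENNReal.ofReal_le_of_le_toReal hsucc
    rwa [ENNReal.ofReal_div_of_pos (by norm_num), ENNReal.ofReal_ofNat, ENNReal.ofReal_ofNat] at h2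
  simp only [hout]
  refine ⟨?_, ?_, ?_, ?_, ?_, ?_⟩
  · refine (hsim.expectedQueries_le hR
      (F := fun ω => (Nat.clog 2 n : ℝ≥0∞) + 5 * (ω.2 : ℝ≥0∞)) fun ω c h => ?_).trans ?_
    · exact_mod_cast h.2.2.1
    · have hne : (expect (repeatTrials tr f (firstTrial n N)) fun x => (x.2 : ℝ≥0∞)) ≠ ⊤ :=
        ((expect_trials_le tr f (firstTrial n N)).trans_lt (ENNReal.natCast_lt_top f)).ne
      rw [expect_add, expect_const, expect_const_mul, pow_one]
      refine ENNReal.le_ofReal_iff_toReal_le ?_ ?_ |>.2 ?_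
      · exact ENNReal.add_ne_top.2 ⟨ENNReal.natCast_ne_top _, ENNReal.mul_ne_top (by simp) hne⟩
      · have := Real.log_natCast_nonneg n
        positivity
      · rw [ENNReal.toReal_add (ENNReal.natCast_ne_top _) (ENNReal.mul_ne_top (by simp) hne),
          ENNReal.toReal_mul]
        simpa [expectedTrials] using hcost
  · exact (D.toOuterMeasure_apply_eq_one_iff _).2 (Set.subset_univ _)
  · exact hsim.linearTime hR fun ω c h => h.2.2.2.trans (Nat.mul_le_mul_right _ (by norm_num))
  · rw [PMF.toOuterMeasure_apply_eq_zero_iff, Set.disjoint_left]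
    rintro _ ho ⟨u, v, rfl, huv⟩
    exact (D.mem_support_iff _).1 ho (hDzero u v huv)
  · rw [toOuterMeasure_edges_eq_sum G D hDzero]
    exact hsum
  · refine exists_pointwiseClose_edgeLaw G D hDzero ?_ ?_
    · intro h0
      rw [h0] at hsum
      norm_num at hsum
    · intro u v huv
      rw [← hm]
      exact hclose u v huv
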